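/- Let $n\ge 0$, let $0<\xi_1<\dots<\xi_n\le 1$ and $g_1,\dots,g_n>0$, and let $g=\sum_{i=1}^n g_i\delta_{\xi_i}$. For $z\in\mathbb C$ let $\phi(\xi;z)$, $0\le\xi\le1$, be the solution of $$-\phi_{\xi\xi\xi}=z\,g\,\phi,\qquad \phi(0)=\phi_\xi(0)=0,\quad \phi_{\xi\xi}(0)=1,$$ and for $a\in\{0,1,2\}$ let $\phi_a^*(\xi;z)$ be the solution of $\phi^*_{\xi\xi\xi}=z\,g\,\phi^*$ whose values $(\phi^*,\phi^*_\xi,\phi^*_{\xi\xi})$ at $\xi=1$ are $(0,0,1)$ for $a=0$, $(0,1,0)$ for $a=1$, and $(1,0,0)$ for $a=2$. (The equations are understood in the sense of distributions; $\phi,\phi_\xi$ are continuous, $\phi_{\xi\xi}$ is taken right-continuous, and $\phi_{\xi\xi}(1)$ is the right-hand limit at $1$, including the jump there if $\xi_n=1$; likewise for $\phi^*_a$.) Let $\sigma_a\subset\mathbb C$ be the spectrum of the boundary value problem of Type $a$, that is, the set of $z$ for which $-f_{\xi\xi\xi}=z\,g\,f$, $f(0)=f_\xi(0)=0$, $\partial_\xi^a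 f(1)=0$ has a nontrivial solution. For $f\in L^2_g[0,1]$ let $$\hat f_a(z)=(-1)^a\int_{[0,1]}\phi_a^*(\xi;z)\,f(\xi)\,dg(\xi)$$ be its generalized Fourier transform of Type $a$. Let $(a,b)\in\{(0,0),(0,1),(1,2),(2,2)\}$; if $\xi_n=1$, only $(a,b)=(2,2)$ is considered. Let $$\alpha=\sum_{x\in\sigma_a}A(x)\,\delta_x,\qquad \beta=\sum_{y\in\sigma_b}B(y)\,\delta_y,$$ where, with $\phi,\phi_\xi,\phi_{\xi\xi}$ and their $z$-derivatives $\phi_z,\phi_{\xi z},\phi_{\xi\xi z}$ evaluated at $\xi=1$ and at the indicated eigenvalue, - $(0,0)$: $A=B=\phi_\xi/\phi_z$; - $(0,1)$: $A=\phi_{\xi\xi}/\phi_z$, $B=-\phi/\phi_{\xi z}$; - $(1,2)$: $A=\phi_{\xi\xi}/\phi_{\xi z}$, $B=-\phi/\phi_{\xi\xi z}$; - $(2,2)$: $A=B=-\phi_\xi/\phi_{\xi\xi z}$. Put $\displaystyle\langle p|q\rangle=\iint\frac{p(x)q(y)}{x+y}\,d\alpha(x)\,d\beta(y)$. Let $\epsilon>0$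 be such that the intervals $(\xi_k-\epsilon,\xi_k+\epsilon)$, $k=1,\dots,n$, are pairwise disjoint, let $\chi_j$ be the indicator function of $(\xi_{n-j}-\epsilon,\xi_{n-j}+\epsilon)$ for $j=0,\dots,n-1$, and let $$p_j=\hat\chi_{a,j},\qquad q_j=\hat\chi_{b,j}$$ be the generalized Fourier transforms of $\chi_j$ of Types $a$ and $b$. Then $\sigma_a$ and $\sigma_b$ are finite sets of positive real numbers and all weights $A(x)$, $B(y)$ are positive, so that $\alpha$ and $\beta$ are finite positive discrete measures on $(0,\infty)$; $p_j$ and $q_j$ are polynomials of degree exactly $j$ with real coefficients for $j=0,\dots,n-1$; and $\{p_j\},\{q_j\}$ are (un-normalized) Cauchy biorthogonal with respect to $\alpha,\beta$: $$\langle p_i|q_j\rangle=0\quad (i\ne j),\qquad \langle p_i|q_i\rangle\ne0 .$$ -/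

import Mathlib

open MeasureTheory

noncomputable section

/-- A discrete cubic string of length `1` with `n` point masses: positive masses `mass i`
at positions `0 < pos 0 < pos 1 < ... < pos (n-1) ≤ 1`.  The degenerate case, with the last
mass placed at the end point `1`, is included here. -/
structure CubicString (n : ℕ) where
  pos : Fin n → ℝ
  mass : Fin n → ℝ
  pos_strictMono : StrictMono pos
  pos_pos : ∀ i, 0 < pos i
  pos_le_one : ∀ i, pos i ≤ 1
  mass_pos : ∀ i, 0 < mass i

namespace CubicString

variable {n : ℕ}

/-- The mass distribution `g = ∑ i, g_i δ_{ξ_i}`. -/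
def g (S : CubicString n) : Measure ℝ :=
  ∑ i, ENNReal.ofReal (S.mass i) • Measure.dirac (S.pos i)

/-- `u x 0 = f(x)`, `u x 1 = f_ξ(x)`, `u x 2 = f_ξξ(x)` for a solution `f` of the
distributional equation `f_ξξξ = w g f` on the string `[0,1]`, in integrated form: `f` and
`f_ξ` are absolutely continuous, `f_ξξ` is the right-continuous representative of the
second derivative, and it has jumps `w g_i f(ξ_i)` at the point masses.  In particular
`u 1 2` is the right-hand limit of the second derivative at `1`, also when a mass sits there. -/
structure Solves (S : CubicString n) (w : ℂ) (u : ℝ → Fin 3 → ℂ) : Prop where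
  eq_zero : ∀ x ∈ Set.Icc (0 : ℝ) 1, u x 0 = u 0 0 + ∫ t in (0 : ℝ)..x, u t 1
  eq_one : ∀ x ∈ Set.Icc (0 : ℝ) 1, u x 1 = u 0 1 + ∫ t in (0 : ℝ)..x, u t 2
  eq_two : ∀ x ∈ Set.Icc (0 : ℝ) 1, u x 2 = u 0 2 + w * ∫ t in Set.Ioc (0 : ℝ) x, u t 0 ∂S.g

/-! Existence of solutions of the initial value problems at `0` and at `1`. -/

theorem setIntegral_g (S : CubicString n) (f : ℝ → ℂ) (s : Set ℝ) [DecidablePred (· ∈ s)]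
    (hs : MeasurableSet s) :
    ∫ t in s, f t ∂S.g = ∑ i, if S.pos i ∈ s then (S.mass i : ℂ) * f (S.pos i) else 0 := by
  rw [← integral_indicator hs, g, integral_finsetSum_measure]
  · refine Finset.sum_congr rfl fun i _ => ?_
    rw [integral_smul_measure, integral_dirac, ENNReal.toReal_ofReal (S.mass_pos i).le,
      Set.indicator_apply]
    split_ifs <;> simp
  · intro i _
    exact (integrable_dirac (by simp)).smul_measure ENNReal.ofReal_ne_top

theorem exists_rec {r : Fin n → Fin n → Prop} (hr : WellFounded r) (a : Fin n → ℂ)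
    (K : Fin n → Fin n → ℂ) (hK : ∀ i k, ¬ r k i → K i k = 0) :
    ∃ c : Fin n → ℂ, ∀ i, c i = a i + ∑ k, K i k * c k := by
  classical
  refine ⟨hr.fix fun i c => a i + ∑ k, if h : r k i then K i k * c k h else 0, fun i => ?_⟩
  rw [hr.fix_eq]
  congr 1
  refine Finset.sum_congr rfl fun k _ => ?_
  split_ifs with h
  · rfl
  · simp [hK i k h]

theorem integral_step (p x : ℝ) (hp : 0 < p) (f : ℝ → ℂ) (hf : Continuous f) :
    IntervalIntegrable (fun t => if p ≤ t then f t else 0) volume 0 x ∧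
    ∫ t in (0 : ℝ)..x, (if p ≤ t then f t else 0) = if p ≤ x then ∫ t in p..x, f t else 0 := by
  have e : (fun t => if p ≤ t then f t else 0) = (Set.Ici p).indicator f := by
    ext t; simp [Set.indicator_apply]
  have hi : ∀ a b, IntervalIntegrable (fun t => if p ≤ t then f t else 0) volume a b := by
    intro a b
    rw [e, intervalIntegrable_iff]
    exact ((intervalIntegrable_iff.1 (hf.intervalIntegrable a b))).indicator measurableSet_Ici
  have hlt : ∀ y, y ≤ p → ∫ t in (0 : ℝ)..y, (if p ≤ t then f t else 0) = 0 := by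
    intro y hy
    refine intervalIntegral.integral_zero_ae ?_
    have : ∀ᵐ t : ℝ, t ≠ p := by simp [ae_iff]
    filter_upwards [this] with t ht hty
    rw [if_neg]
    intro hpt
    rcases Set.mem_uIoc.1 hty with h | h
    · exact ht (le_antisymm (h.2.trans hy) hpt)
    · linarith [h.2]
  refine ⟨hi _ _, ?_⟩
  split_ifs with h
  · rw [← intervalIntegral.integral_add_adjacent_intervals (hi 0 p) (hi p x), hlt p le_rfl,
      zero_add]
    refine intervalIntegral.integral_congr fun t ht => ?_
    rw [Set.uIcc_of_le h] at ht
    simp [ht.1]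
  · exact hlt x (not_le.1 h).le

theorem integral_shift (p x : ℝ) : ∫ t in p..x, ((t - p : ℝ) : ℂ) = ((x - p) ^ 2 / 2 : ℝ) := by
  rw [intervalIntegral.integral_ofReal, intervalIntegral.integral_sub (by simp) (by simp)]
  norm_cast
  rw [integral_id]
  simp
  ring

/-- The piecewise quadratic function with second derivative `q2` near `0` and with jumps
`w g_i c_i` of the second derivative, together with its first two derivatives. -/
def ansatz (S : CubicString n) (w q0 q1 q2 : ℂ) (c : Fin n → ℂ) (x : ℝ) : Fin 3 → ℂ :=
  ![q0 + q1 * x + q2 * (x ^ 2 / 2 : ℝ) + ∑ i, w * S.mass i * c i *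
      (if S.pos i ≤ x then (((x - S.pos i) ^ 2 / 2 : ℝ) : ℂ) else 0),
    q1 + q2 * x + ∑ i, w * S.mass i * c i *
      (if S.pos i ≤ x then ((x - S.pos i : ℝ) : ℂ) else 0),
    q2 + ∑ i, w * S.mass i * c i * (if S.pos i ≤ x then 1 else 0)]

theorem solves_ansatz (S : CubicString n) (w q0 q1 q2 : ℂ) (c : Fin n → ℂ)
    (hc : ∀ i, c i = S.ansatz w q0 q1 q2 c (S.pos i) 0) :
    S.Solves w (S.ansatz w q0 q1 q2 c) := by
  have hneg : ∀ i, ¬ S.pos i ≤ 0 := fun i => not_le.2 (S.pos_pos i)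
  have i1 : ∀ i x, _ := fun i x =>
    integral_step (S.pos i) x (S.pos_pos i) (fun t => ((t - S.pos i : ℝ) : ℂ)) (by fun_prop)
  have i2 : ∀ i x, _ := fun i x =>
    integral_step (S.pos i) x (S.pos_pos i) (fun _ => (1 : ℂ)) (by fun_prop)
  refine ⟨fun x hx => ?_, fun x hx => ?_, fun x hx => ?_⟩
  · simp only [ansatz, Matrix.cons_val]
    rw [intervalIntegral.integral_add, intervalIntegral.integral_finsetSum]
    · simp only [intervalIntegral.integral_const_mul, (i1 _ x).2, integral_shift, hneg, if_false]
      rw [intervalIntegral.integral_add (by simp)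
        ((by fun_prop : Continuous fun t : ℝ => q2 * (t : ℂ)).intervalIntegrable _ _),
        intervalIntegral.integral_const_mul]
      have := integral_shift 0 x
      simp only [sub_zero] at this
      rw [this]
      simp
      ring
    · intro i _
      exact (i1 i x).1.const_mul _
    · exact (by fun_prop : Continuous fun t : ℝ => q1 + q2 * (t : ℂ)).intervalIntegrable _ _
    · have := IntervalIntegrable.sum Finset.univ fun i _ =>
        (i1 i x).1.const_mul (w * S.mass i * c i)
      rw [Finset.sum_fn] at this
      exact this
  · simp only [ansatz, Matrix.cons_val]
    rw [intervalIntegral.integral_add, intervalIntegral.integral_finsetSum]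
    · simp only [intervalIntegral.integral_const_mul, (i2 _ x).2, hneg, if_false]
      simp
      ring
    · intro i _
      exact (i2 i x).1.const_mul _
    · simp
    · have := IntervalIntegrable.sum Finset.univ fun i _ =>
        (i2 i x).1.const_mul (w * S.mass i * c i)
      rw [Finset.sum_fn] at this
      exact this
  · classical
    rw [setIntegral_g S _ _ measurableSet_Ioc]
    simp only [← hc]
    simp only [ansatz, Matrix.cons_val, hneg, if_false, Set.mem_Ioc, S.pos_pos, true_and,
      Finset.mul_sum]
    simp [mul_assoc]

theorem exists_solves_left (S : CubicString n) (w : ℂ) (d : Fin 3 → ℂ) :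
    ∃ u, S.Solves w u ∧ u 0 = d := by
  obtain ⟨c, hc⟩ := exists_rec (r := fun k i : Fin n => k < i) wellFounded_lt
    (fun i => d 0 + d 1 * S.pos i + d 2 * ((S.pos i) ^ 2 / 2 : ℝ))
    (fun i k => w * S.mass k *
      (if S.pos k ≤ S.pos i then (((S.pos i - S.pos k) ^ 2 / 2 : ℝ) : ℂ) else 0)) (by
      intro i k h
      rcases (not_lt.1 h).eq_or_lt with h | h
      · simp [h]
      · rw [if_neg (not_le.2 (S.pos_strictMono h)), mul_zero])
  refine ⟨S.ansatz w (d 0) (d 1) (d 2) c, S.solves_ansatz _ _ _ _ _ fun i => ?_, ?_⟩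
  · rw [hc i]
    simp only [ansatz, Matrix.cons_val]
    congr 1
    exact Finset.sum_congr rfl fun k _ => by ring
  · have hneg : ∀ i, ¬ S.pos i ≤ 0 := fun i => not_le.2 (S.pos_pos i)
    ext j
    fin_cases j <;> simp [ansatz, hneg]

theorem exists_solves_right (S : CubicString n) (w : ℂ) (d : Fin 3 → ℂ) :
    ∃ u, S.Solves w u ∧ u 1 = d := by
  obtain ⟨c, hc⟩ := exists_rec (r := fun k i : Fin n => k > i) wellFounded_gt
    (fun i => d 0 + d 1 * (S.pos i - 1) + d 2 * ((S.pos i - 1) ^ 2 / 2))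
    (fun i k => - (w * S.mass k *
      (if S.pos k ≤ S.pos i then 0 else (((S.pos i - S.pos k) ^ 2 / 2 : ℝ) : ℂ)))) (by
      intro i k h
      rw [if_pos (S.pos_strictMono.monotone (not_lt.1 h)), mul_zero, neg_zero])
  set q2 := d 2 - ∑ k, w * S.mass k * c k with hq2
  set q1 := d 1 - q2 - ∑ k, w * S.mass k * c k * ((1 - S.pos k : ℝ) : ℂ) with hq1
  set q0 := d 0 - q1 - q2 / 2 -
    ∑ k, w * S.mass k * c k * (((1 - S.pos k) ^ 2 / 2 : ℝ) : ℂ) with hq0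
  refine ⟨S.ansatz w q0 q1 q2 c, S.solves_ansatz _ _ _ _ _ fun i => ?_, ?_⟩
  · rw [hc i]
    simp only [ansatz, Matrix.cons_val]
    have h1 : ∀ k, w * S.mass k * c k *
        (if S.pos k ≤ S.pos i then (((S.pos i - S.pos k) ^ 2 / 2 : ℝ) : ℂ) else 0) =
        w * S.mass k * c k * (((1 - S.pos k) ^ 2 / 2 : ℝ) : ℂ)
        + (w * S.mass k * c k * ((1 - S.pos k : ℝ) : ℂ)) * (S.pos i - 1)
        + (w * S.mass k * c k) * ((S.pos i - 1) ^ 2 / 2)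
        + - (w * S.mass k * (if S.pos k ≤ S.pos i then 0 else
          (((S.pos i - S.pos k) ^ 2 / 2 : ℝ) : ℂ))) * c k := by
      intro k
      split_ifs <;> push_cast <;> ring
    simp only [h1, Finset.sum_add_distrib, ← Finset.sum_mul]
    rw [hq0, hq1, hq2]
    push_cast
    ring
  · have hle := S.pos_le_one
    ext j
    fin_cases j <;> simp only [ansatz, hle, if_true] <;> simp [hq0, hq1, hq2] <;> ring

/-- The solution `(φ, φ_ξ, φ_ξξ)(ξ; z)` of `-φ_ξξξ = z g φ` with
`φ(0) = φ_ξ(0) = 0`, `φ_ξξ(0) = 1`. -/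
def phi (S : CubicString n) (z : ℂ) : ℝ → Fin 3 → ℂ :=
  (S.exists_solves_left (-z) ![0, 0, 1]).choose

theorem phi_spec (S : CubicString n) (z : ℂ) :
    S.Solves (-z) (S.phi z) ∧ S.phi z 0 = ![0, 0, 1] :=
  (S.exists_solves_left (-z) ![0, 0, 1]).choose_spec

/-- The initial values `(φ*, φ*_ξ, φ*_ξξ)(1)` of the adjoint problem of type `a`. -/
def adjointInit : Fin 3 → Fin 3 → ℂ
  | 0 => ![0, 0, 1]
  | 1 => ![0, 1, 0]
  | 2 => ![1, 0, 0]

/-- The solution `(φ*_a, φ*_{a,ξ}, φ*_{a,ξξ})(ξ; z)` of the adjoint initial value problem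
`φ*_ξξξ = z g φ*` of type `a`, with initial values prescribed at `1`. -/
def phiStar (S : CubicString n) (a : Fin 3) (z : ℂ) : ℝ → Fin 3 → ℂ :=
  (S.exists_solves_right z (adjointInit a)).choose

theorem phiStar_spec (S : CubicString n) (a : Fin 3) (z : ℂ) :
    S.Solves z (S.phiStar a z) ∧ S.phiStar a z 1 = adjointInit a :=
  (S.exists_solves_right z (adjointInit a)).choose_spec

/-- The spectrum of the boundary value problem of type `a`: `-f_ξξξ = z g f`,
`f(0) = f_ξ(0) = 0`, and the derivative of order `a` of `f` vanishes at `1`. -/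
def spectrum (S : CubicString n) (a : Fin 3) : Set ℂ :=
  {z | ∃ u, S.Solves (-z) u ∧ u 0 0 = 0 ∧ u 0 1 = 0 ∧ u 1 a = 0 ∧
    ∃ x ∈ Set.Icc (0 : ℝ) 1, u x 0 ≠ 0}

/-- The generalized Fourier transform of type `a`:
`(-1)^a ∫_[0,1] φ*_a(ξ; z) f(ξ) dg(ξ)`. -/
def fourier (S : CubicString n) (a : Fin 3) (f : ℝ → ℂ) (z : ℂ) : ℂ :=
  (-1) ^ (a : ℕ) * ∫ x in Set.Icc (0 : ℝ) 1, S.phiStar a z x 0 * f x ∂S.g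

/-- The residue `N(z) / ∂_z φ^(a)(1; z)` of the Weyl function `N / φ^(a)(1; ·)` at an
eigenvalue `z` of type `a`, where `φ^(a)` is the `ξ`-derivative of order `a`. -/
def weight (S : CubicString n) (a : Fin 3) (N : ℂ → ℂ) (z : ℂ) : ℂ :=
  N z / deriv (fun y => S.phi y 1 a) z

/-- The discrete measure `∑ N(x) / (∂_z φ^(a)(1; x)) δ_x` over the eigenvalues `x` of
type `a`, whose Stieltjes transform is the Weyl function `N(z) / φ^(a)(1; z)`. -/
def spectralMeasure (S : CubicString n) (a : Fin 3) (N : ℂ → ℂ) : Measure ℝ :=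
  Measure.sum fun x : {x : ℝ // (x : ℂ) ∈ S.spectrum a} =>
    ENNReal.ofReal (S.weight a N (x : ℝ)).re • Measure.dirac (x : ℝ)

end CubicString

/-- The pairs `a b` of types of boundary value problems for which the inner products
`(φ_{a,i}, φ_{b,j})_g` of the eigenfunctions factorize. -/
inductive TypePair
  | t00
  | t01
  | t12
  | t22

namespace TypePair

/-- The first type `a` of the pair. -/
def fst : TypePair → Fin 3
  | t00 => 0
  | t01 => 0
  | t12 => 1
  | t22 => 2

/-- The second type `b` of the pair. -/
def snd : TypePair → Fin 3
  | t00 => 0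
  | t01 => 1
  | t12 => 2
  | t22 => 2

/-- The numerator of the Weyl function generating `α`:
`φ_ξ/φ`, `φ_ξξ/φ`, `φ_ξξ/φ_ξ`, `-φ_ξ/φ_ξξ` at `ξ = 1`, respectively. -/
def numA {n : ℕ} (S : CubicString n) : TypePair → ℂ → ℂ
  | t00 => fun z => S.phi z 1 1
  | t01 => fun z => S.phi z 1 2
  | t12 => fun z => S.phi z 1 2
  | t22 => fun z => -S.phi z 1 1

/-- The numerator of the Weyl function generating `β`:
`φ_ξ/φ`, `-φ/φ_ξ`, `-φ/φ_ξξ`, `-φ_ξ/φ_ξξ` at `ξ = 1`, respectively. -/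
def numB {n : ℕ} (S : CubicString n) : TypePair → ℂ → ℂ
  | t00 => fun z => S.phi z 1 1
  | t01 => fun z => -S.phi z 1 0
  | t12 => fun z => -S.phi z 1 0
  | t22 => fun z => -S.phi z 1 1

end TypePair

namespace CubicString

variable {n : ℕ}

/-- The measure `α` of the pair of types `T`. -/
def alpha (S : CubicString n) (T : TypePair) : Measure ℝ := S.spectralMeasure T.fst (T.numA S)

/-- The measure `β` of the pair of types `T`. -/
def beta (S : CubicString n) (T : TypePair) : Measure ℝ := S.spectralMeasure T.snd (T.numB S)

/-- The pairing `⟨p|q⟩ = ∫∫ p(x) q(y) / (x + y) dα(x) dβ(y)`. -/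
def pairing (S : CubicString n) (T : TypePair) (p q : ℂ → ℂ) : ℂ :=
  ∫ x : ℝ, ∫ y : ℝ, p x * q y / ((x : ℂ) + (y : ℂ)) ∂(S.beta T) ∂(S.alpha T)

/-- The interval `(ξ_{n-j} - ε, ξ_{n-j} + ε)`, for `j = 0, ..., n - 1`; masses are counted
from the right end. -/
def window (S : CubicString n) (ε : ℝ) (j : Fin n) : Set ℝ :=
  Set.Ioo (S.pos j.rev - ε) (S.pos j.rev + ε)

/-- The indicator function `χ_j` of the interval around `ξ_{n-j}`. -/
def chi (S : CubicString n) (ε : ℝ) (j : Fin n) : ℝ → ℂ :=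
  (S.window ε j).indicator fun _ => 1

end CubicString

end

noncomputable section

namespace CubicString

open Polynomial

variable {n : ℕ}

/-! Everything rests on the Lagrange identity (`Solves.lagrange`): for solutions u, v with
parameters w, w', the form u_ξξ v - u_ξ v_ξ + u v_ξξ is constant between masses and jumps by (w +
w') g_i u v at a mass. Applied to φ(·; x) and φ(·; y) at eigenvalues of types a and b, the boundary
conditions leave one term at 1, so the product of the two Weyl numerators is x + y times the g-inner
product of the eigenfunctions (`numA_mul_numB`). This cancels the Cauchy kernel.

Applied to φ(·; z) and φ*_a(·; w), it makes eigenfunctions and adjoint eigenfunctions biorthogonal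
in L²_g, with norm the z-derivative of φ^(a)(1; z) up to sign. There are exactly n eigenvalues, so
the matrices involved are square and a one-sided inverse is two-sided: this is completeness
(`sum_eigenvalues_phi_phiStar`). The pairing then collapses to a sum over the masses of products of
Kronecker deltas (`pairing_fourier`).

Reality, simplicity and positive weights come from sign conditions transported along the string over
ℝ[δ], δ² = -d (`strictInterlacing_one`). For d = 1 these are complex numbers, and zeros off the real
axis are excluded; for d = 0 they are dual numbers recording value and z-derivative, and the signs
of the residues result. The degrees come from triangular recursions with nonvanishing subdiagonal
(`exists_degree_eq`). -/

/-! ### Uniqueness: solutions are piecewise quadratic -/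

theorem ansatz_apply_one (S : CubicString n) (w q0 q1 q2 : ℂ) (c : Fin n → ℂ) (x : ℝ) :
    S.ansatz w q0 q1 q2 c x 1 = q1 + ∫ t in (0 : ℝ)..x, S.ansatz w q0 q1 q2 c t 2 := by
  have i2 : ∀ i x, _ := fun i x =>
    integral_step (S.pos i) x (S.pos_pos i) (fun _ => (1 : ℂ)) (by fun_prop)
  simp only [ansatz, Matrix.cons_val]
  rw [intervalIntegral.integral_add, intervalIntegral.integral_finsetSum]
  · simp only [intervalIntegral.integral_const_mul, (i2 _ x).2]
    simp
    ring
  · intro i _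
    exact (i2 i x).1.const_mul _
  · simp
  · have := IntervalIntegrable.sum Finset.univ fun i _ =>
      (i2 i x).1.const_mul (w * S.mass i * c i)
    rw [Finset.sum_fn] at this
    exact this

theorem ansatz_apply_zero (S : CubicString n) (w q0 q1 q2 : ℂ) (c : Fin n → ℂ) (x : ℝ) :
    S.ansatz w q0 q1 q2 c x 0 = q0 + ∫ t in (0 : ℝ)..x, S.ansatz w q0 q1 q2 c t 1 := by
  have i1 : ∀ i x, _ := fun i x =>
    integral_step (S.pos i) x (S.pos_pos i) (fun t => ((t - S.pos i : ℝ) : ℂ)) (by fun_prop)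
  simp only [ansatz, Matrix.cons_val]
  rw [intervalIntegral.integral_add, intervalIntegral.integral_finsetSum]
  · simp only [intervalIntegral.integral_const_mul, (i1 _ x).2, integral_shift]
    rw [intervalIntegral.integral_add (by simp)
      ((by fun_prop : Continuous fun t : ℝ => q2 * (t : ℂ)).intervalIntegrable _ _),
      intervalIntegral.integral_const_mul]
    have := integral_shift 0 x
    simp only [sub_zero] at this
    rw [this]
    simp
    ring
  · intro i _
    exact (i1 i x).1.const_mul _
  · exact (by fun_prop : Continuous fun t : ℝ => q1 + q2 * (t : ℂ)).intervalIntegrable _ _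
  · have := IntervalIntegrable.sum Finset.univ fun i _ =>
      (i1 i x).1.const_mul (w * S.mass i * c i)
    rw [Finset.sum_fn] at this
    exact this

/-- The jumps fix the second derivative; two integrations from 0 then recover the first derivative
and the function. -/
theorem Solves.eq_ansatz {S : CubicString n} {w : ℂ} {u : ℝ → Fin 3 → ℂ} (h : S.Solves w u)
    {x : ℝ} (hx : x ∈ Set.Icc (0 : ℝ) 1) (j : Fin 3) :
    u x j = S.ansatz w (u 0 0) (u 0 1) (u 0 2) (fun i => u (S.pos i) 0) x j := by
  classical
  set v := S.ansatz w (u 0 0) (u 0 1) (u 0 2) (fun i => u (S.pos i) 0) with hv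
  have h2 : ∀ x ∈ Set.Icc (0 : ℝ) 1, u x 2 = v x 2 := by
    intro x hx
    rw [h.eq_two x hx, setIntegral_g S _ _ measurableSet_Ioc]
    simp only [hv, ansatz, Matrix.cons_val, Set.mem_Ioc, S.pos_pos, true_and, Finset.mul_sum]
    simp [mul_assoc]
  have hsub : ∀ x ∈ Set.Icc (0 : ℝ) 1, ∀ t ∈ Set.uIcc 0 x, t ∈ Set.Icc (0 : ℝ) 1 := by
    intro x hx t ht
    rw [Set.uIcc_of_le hx.1] at ht
    exact ⟨ht.1, ht.2.trans hx.2⟩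
  have h1 : ∀ x ∈ Set.Icc (0 : ℝ) 1, u x 1 = v x 1 := by
    intro x hx
    rw [h.eq_one x hx, hv, ansatz_apply_one, ← hv]
    congr 1
    exact intervalIntegral.integral_congr fun t ht => h2 t (hsub x hx t ht)
  have h0 : ∀ x ∈ Set.Icc (0 : ℝ) 1, u x 0 = v x 0 := by
    intro x hx
    rw [h.eq_zero x hx, hv, ansatz_apply_zero, ← hv]
    congr 1
    exact intervalIntegral.integral_congr fun t ht => h1 t (hsub x hx t ht)
  fin_cases j
  · exact h0 x hx
  · exact h1 x hx
  · exact h2 x hx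

/-! ### Transfer across gaps between masses -/

theorem pos_mem (S : CubicString n) (i : Fin n) : S.pos i ∈ Set.Icc (0 : ℝ) 1 :=
  ⟨(S.pos_pos i).le, S.pos_le_one i⟩

/-- The mass sitting at the point `b`. -/
def massAt (S : CubicString n) (b : ℝ) : ℝ := ∑ i, if S.pos i = b then S.mass i else 0

theorem massAt_nonneg (S : CubicString n) (b : ℝ) : 0 ≤ S.massAt b :=
  Finset.sum_nonneg fun i _ => by split_ifs <;> simp [(S.mass_pos i).le]

/-- No mass lies strictly between `a` and `b`. -/
structure IsGap (S : CubicString n) (a b : ℝ) : Prop where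
  nonneg : 0 ≤ a
  lt : a < b
  le_one : b ≤ 1
  gap : ∀ i, S.pos i ≤ a ∨ b ≤ S.pos i

theorem IsGap.mem_left {S : CubicString n} {a b : ℝ} (h : S.IsGap a b) :
    a ∈ Set.Icc (0 : ℝ) 1 := ⟨h.nonneg, h.lt.le.trans h.le_one⟩

theorem IsGap.mem_right {S : CubicString n} {a b : ℝ} (h : S.IsGap a b) :
    b ∈ Set.Icc (0 : ℝ) 1 := ⟨h.nonneg.trans h.lt.le, h.le_one⟩

theorem IsGap.sum_le {S : CubicString n} {a b : ℝ} (h : S.IsGap a b) (f : Fin n → ℂ) :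
    (∑ i, if S.pos i ≤ b then f i else 0) =
      (∑ i, if S.pos i ≤ a then f i else 0) + ∑ i, if S.pos i = b then f i else 0 := by
  rw [← Finset.sum_add_distrib]
  refine Finset.sum_congr rfl fun i _ => ?_
  have := h.lt
  rcases h.gap i with hi | hi
  · rw [if_pos (by linarith), if_pos hi, if_neg (by linarith), add_zero]
  · rw [if_neg (by linarith : ¬ S.pos i ≤ a), zero_add]
    exact if_congr ⟨fun h => le_antisymm h hi, fun h => h.le⟩ rfl rfl

/-- Every property that propagates through gaps holds on the whole string. -/
theorem string_induction (S : CubicString n) {P : ℝ → Prop} (h0 : P 0)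
    (hs : ∀ a b, S.IsGap a b → P a → P b) : ∀ x ∈ Set.Icc (0 : ℝ) 1, P x := by
  -- Strong induction on the number of masses strictly left of `x`: the last of them, or 0 if there
  -- is none, is the left end of a gap ending at `x`.
  classical
  suffices H : ∀ m : ℕ, ∀ x ∈ Set.Icc (0 : ℝ) 1,
      (Finset.univ.filter fun i => S.pos i < x).card = m → P x from
    fun x hx => H _ x hx rfl
  intro m
  induction m using Nat.strong_induction_on with
  | _ m ih =>
    intro x hx hm
    rcases hx.1.eq_or_lt with rfl | hx0
    · exact h0
    rcases (Finset.univ.filter fun i => S.pos i < x).eq_empty_or_nonempty with he | he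
    · refine hs 0 x ⟨le_rfl, hx0, hx.2, fun i => Or.inr (not_lt.1 fun hi => ?_)⟩ h0
      have : i ∈ (Finset.univ.filter fun i => S.pos i < x) := by simp [hi]
      simp [he] at this
    · obtain ⟨i, hi, hmax⟩ := Finset.exists_max_image _ S.pos he
      simp only [Finset.mem_filter, Finset.mem_univ, true_and] at hi hmax
      refine hs (S.pos i) x ⟨(S.pos_pos i).le, hi, hx.2, fun k => ?_⟩ ?_
      · by_cases hk : S.pos k < x
        · exact Or.inl (hmax k hk)
        · exact Or.inr (not_lt.1 hk)
      · refine ih _ ?_ _ (S.pos_mem i) rfl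
        rw [← hm]
        refine Finset.card_lt_card ⟨fun k hk => ?_, fun hss => ?_⟩
        · simp only [Finset.mem_filter, Finset.mem_univ, true_and] at hk ⊢
          exact hk.trans hi
        · have := hss (show i ∈ _ by simp [hi])
          simp at this

theorem Solves.step {S : CubicString n} {w : ℂ} {u : ℝ → Fin 3 → ℂ} (h : S.Solves w u)
    {a b : ℝ} (hab : S.IsGap a b) :
    u b 0 = u a 0 + (b - a : ℝ) * u a 1 + ((b - a) ^ 2 / 2 : ℝ) * u a 2 ∧
    u b 1 = u a 1 + (b - a : ℝ) * u a 2 ∧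
    u b 2 = u a 2 + w * S.massAt b * u b 0 := by
  have lt := hab.lt
  -- A mass at `b` does not affect the value and slope there, its kernel being zero at `b`; the
  -- kernels of masses up to `a` are Taylor-expanded about `a`.
  have key : ∀ (i : Fin n) (f g : ℂ), (S.pos i = b → f = 0) → (S.pos i ≤ a → f = g) →
      (if S.pos i ≤ b then f else 0) = if S.pos i ≤ a then g else 0 := by
    intro i f g h1 h2
    rcases hab.gap i with hi | hi
    · rw [if_pos (by linarith), if_pos hi, h2 hi]
    · rw [if_neg (by linarith : ¬ S.pos i ≤ a)]
      split_ifs with h3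
      · exact h1 (le_antisymm h3 hi)
      · rfl
  refine ⟨?_, ?_, ?_⟩
  · rw [h.eq_ansatz hab.mem_right, h.eq_ansatz hab.mem_left, h.eq_ansatz hab.mem_left,
      h.eq_ansatz hab.mem_left]
    simp only [ansatz, Matrix.cons_val]
    rw [Finset.sum_congr rfl fun i _ => congrArg _ (key i _ ((((a - S.pos i) ^ 2 / 2 : ℝ) : ℂ)
      + (b - a : ℝ) * (a - S.pos i : ℝ) + ((b - a) ^ 2 / 2 : ℝ)) ?_ ?_)]
    · have : ∀ i, w * S.mass i * u (S.pos i) 0 * (if S.pos i ≤ a then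
          ((((a - S.pos i) ^ 2 / 2 : ℝ) : ℂ) + (b - a : ℝ) * (a - S.pos i : ℝ) +
          ((b - a) ^ 2 / 2 : ℝ)) else 0) =
          w * S.mass i * u (S.pos i) 0 * (if S.pos i ≤ a then
            (((a - S.pos i) ^ 2 / 2 : ℝ) : ℂ) else 0) +
          (b - a : ℝ) * (w * S.mass i * u (S.pos i) 0 * (if S.pos i ≤ a then
            ((a - S.pos i : ℝ) : ℂ) else 0)) +
          ((b - a) ^ 2 / 2 : ℝ) * (w * S.mass i * u (S.pos i) 0 *
            (if S.pos i ≤ a then 1 else 0)) := by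
        intro i; split_ifs <;> ring
      simp only [this, Finset.sum_add_distrib, ← Finset.mul_sum]
      push_cast
      ring
    · intro hi; simp [hi]
    · intro _; push_cast; ring
  · rw [h.eq_ansatz hab.mem_right, h.eq_ansatz hab.mem_left, h.eq_ansatz hab.mem_left]
    simp only [ansatz, Matrix.cons_val]
    rw [Finset.sum_congr rfl fun i _ => congrArg _ (key i _ (((a - S.pos i : ℝ) : ℂ)
      + (b - a : ℝ)) ?_ ?_)]
    · have : ∀ i, w * S.mass i * u (S.pos i) 0 * (if S.pos i ≤ a then
          (((a - S.pos i : ℝ) : ℂ) + (b - a : ℝ)) else 0) =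
          w * S.mass i * u (S.pos i) 0 * (if S.pos i ≤ a then
            ((a - S.pos i : ℝ) : ℂ) else 0) +
          (b - a : ℝ) * (w * S.mass i * u (S.pos i) 0 *
            (if S.pos i ≤ a then 1 else 0)) := by
        intro i; split_ifs <;> ring
      simp only [this, Finset.sum_add_distrib, ← Finset.mul_sum]
      push_cast
      ring
    · intro hi; simp [hi]
    · intro _; push_cast; ring
  · rw [h.eq_ansatz hab.mem_right 2, h.eq_ansatz hab.mem_left]
    simp only [ansatz, Matrix.cons_val, mul_ite, mul_one, mul_zero]
    rw [hab.sum_le, add_assoc]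
    congr 2
    rw [massAt]
    push_cast
    rw [Finset.mul_sum, Finset.sum_mul]
    refine Finset.sum_congr rfl fun i _ => ?_
    split_ifs with hi
    · rw [hi]
    · simp

/-! ### The solution φ and the spectrum -/

theorem Solves.eq_mul_phi {S : CubicString n} {z : ℂ} {u : ℝ → Fin 3 → ℂ}
    (h : S.Solves (-z) u) (h0 : u 0 0 = 0) (h1 : u 0 1 = 0) :
    ∀ x ∈ Set.Icc (0 : ℝ) 1, ∀ j, u x j = u 0 2 * S.phi z x j := by
  obtain ⟨hp, hi⟩ := S.phi_spec z
  refine S.string_induction ?_ fun a b hab ih => ?_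
  · intro j
    rw [hi]
    fin_cases j <;> simp [h0, h1]
  · obtain ⟨e0, e1, e2⟩ := h.step hab
    obtain ⟨f0, f1, f2⟩ := hp.step hab
    have g0 : u b 0 = u 0 2 * S.phi z b 0 := by
      rw [e0, f0, ih, ih, ih]; ring
    intro j
    fin_cases j
    · exact g0
    · simp only [Fin.mk_one]; rw [e1, f1, ih, ih]; ring
    · simp only [Fin.reduceFinMk]; rw [e2, f2, ih, g0]; ring

theorem exists_phi_ne_zero (S : CubicString n) (z : ℂ) :
    ∃ x ∈ Set.Icc (0 : ℝ) 1, S.phi z x 0 ≠ 0 := by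
  by_contra! H
  obtain ⟨hp, hi⟩ := S.phi_spec z
  have h1 := hp.eq_ansatz (x := 1) (by simp) 0
  have h2 : ∀ i, S.phi z (S.pos i) 0 = 0 := fun i => H _ (S.pos_mem i)
  rw [H 1 (by simp)] at h1
  -- Without jumps φ would be ξ²/2, which is nonzero at 1.
  simp [ansatz, hi, h2] at h1

theorem mem_spectrum_iff (S : CubicString n) (a : Fin 3) (z : ℂ) :
    z ∈ S.spectrum a ↔ S.phi z 1 a = 0 := by
  constructor
  · rintro ⟨u, hu, h0, h1, ha, x, hx, hne⟩
    have := hu.eq_mul_phi h0 h1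
    rw [this 1 (by simp)] at ha
    rw [this x hx] at hne
    exact (mul_eq_zero.1 ha).resolve_left (left_ne_zero_of_mul hne)
  · intro h
    obtain ⟨hp, hi⟩ := S.phi_spec z
    exact ⟨_, hp, by simp [hi], by simp [hi], h, S.exists_phi_ne_zero z⟩

/-! ### The Lagrange identity -/

theorem Solves.lagrange {S : CubicString n} {w w' : ℂ} {u v : ℝ → Fin 3 → ℂ}
    (hu : S.Solves w u) (hv : S.Solves w' v) : ∀ x ∈ Set.Icc (0 : ℝ) 1,
    u x 2 * v x 0 - u x 1 * v x 1 + u x 0 * v x 2 =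
      u 0 2 * v 0 0 - u 0 1 * v 0 1 + u 0 0 * v 0 2 + (w + w') *
        ∑ i, if S.pos i ≤ x then S.mass i * (u (S.pos i) 0 * v (S.pos i) 0) else 0 := by
  refine S.string_induction ?_ fun a b hab ih => ?_
  · simp [not_le.2 (S.pos_pos _)]
  · obtain ⟨e0, e1, e2⟩ := hu.step hab
    obtain ⟨f0, f1, f2⟩ := hv.step hab
    have : (∑ i, if S.pos i = b then S.mass i * (u (S.pos i) 0 * v (S.pos i) 0) else 0) =
        S.massAt b * (u b 0 * v b 0) := by
      rw [massAt]
      push_cast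
      rw [Finset.sum_mul]
      refine Finset.sum_congr rfl fun i _ => ?_
      split_ifs with hi
      · rw [hi]
      · simp
    rw [hab.sum_le, mul_add, ← add_assoc, ← ih, this, e2, f2, e1, f1]
    have : (u a 2 + w * S.massAt b * u b 0) * v b 0 -
        (u a 1 + (b - a : ℝ) * u a 2) * (v a 1 + (b - a : ℝ) * v a 2) +
        u b 0 * (v a 2 + w' * S.massAt b * v b 0) = u a 2 * v b 0 + u b 0 * v a 2 -
        (u a 1 + (b - a : ℝ) * u a 2) * (v a 1 + (b - a : ℝ) * v a 2) +
        (w + w') * (S.massAt b * (u b 0 * v b 0)) := by ring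
    rw [this, e0, f0]
    push_cast
    ring

theorem Solves.lagrange_one {S : CubicString n} {w w' : ℂ} {u v : ℝ → Fin 3 → ℂ}
    (hu : S.Solves w u) (hv : S.Solves w' v) :
    u 1 2 * v 1 0 - u 1 1 * v 1 1 + u 1 0 * v 1 2 =
      u 0 2 * v 0 0 - u 0 1 * v 0 1 + u 0 0 * v 0 2 + (w + w') *
        ∑ i, S.mass i * (u (S.pos i) 0 * v (S.pos i) 0) := by
  simpa [S.pos_le_one] using hu.lagrange hv 1 (by simp)

/-- The symplectic form on the plane: for complex numbers this is `Im (f * conj g)`, and for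
values and derivatives of functions it is the Wronskian `f' g - f g'`. -/
def wedge (f g : ℝ × ℝ) : ℝ := f.2 * g.1 - f.1 * g.2

/-- Multiplication by `x + y δ` in the algebra `ℝ[δ]` with `δ ^ 2 = -d`. -/
def twist (d x y : ℝ) (f : ℝ × ℝ) : ℝ × ℝ := (x * f.1 - d * y * f.2, x * f.2 + y * f.1)

/-- The triple `(r, q, p)` is interlacing. -/
structure Interlacing (d x y : ℝ) (p q r : ℝ × ℝ) : Prop where
  pq : 0 ≤ wedge p q
  pr : 0 ≤ wedge p r
  qr : 0 ≤ wedge q r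
  tpq : 0 ≤ wedge (twist d x y p) q
  tpr : 0 ≤ wedge (twist d x y p) r
  tqr : 0 ≤ wedge (twist d x y q) r

/-- The triple `(r, q, p)` is strictly interlacing. -/
structure StrictInterlacing (d x y : ℝ) (p q r : ℝ × ℝ) : Prop where
  pq : 0 < wedge (twist d x y p) q
  pr : 0 < wedge (twist d x y p) r
  qr : 0 < wedge (twist d x y q) r

/-- By bilinearity each new form is a nonnegative combination of old ones plus multiples of `wedge
(twist d x y f) f`, which is y times the norm f_1² + d f_2². The cross terms in q and r complete a
square at q + (l/2) r. Strictness is inherited, or created from the initial data because (1, 0) has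
norm 1. -/
theorem Interlacing.propagate {d x y l : ℝ} {p q r : ℝ × ℝ} (hd : 0 ≤ d) (hy : 0 < y)
    (hl : 0 < l) (h : Interlacing d x y p q r) :
    Interlacing d x y (p + l • q + (l ^ 2 / 2) • r) (q + l • r) r ∧
    (StrictInterlacing d x y p q r ∨ (p = 0 ∧ q = 0 ∧ r = (1, 0)) →
      StrictInterlacing d x y (p + l • q + (l ^ 2 / 2) • r) (q + l • r) r) := by
  obtain ⟨p0, p1⟩ := p
  obtain ⟨q0, q1⟩ := q
  obtain ⟨r0, r1⟩ := r
  obtain ⟨h1, h2, h3, h4, h5, h6⟩ := h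
  have hl2 : 0 < l ^ 2 / 2 := by positivity
  have N : 0 ≤ y * (r0 ^ 2 + d * r1 ^ 2) := by positivity
  have e1 : wedge ((p0, p1) + l • (q0, q1) + (l ^ 2 / 2) • (r0, r1)) ((q0, q1) + l • (r0, r1)) =
      wedge (p0, p1) (q0, q1) + l * wedge (p0, p1) (r0, r1) +
      l ^ 2 / 2 * wedge (q0, q1) (r0, r1) := by
    simp [wedge]; ring
  have e2 : wedge ((p0, p1) + l • (q0, q1) + (l ^ 2 / 2) • (r0, r1)) (r0, r1) =
      wedge (p0, p1) (r0, r1) + l * wedge (q0, q1) (r0, r1) := by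
    simp [wedge]; ring
  have e3 : wedge ((q0, q1) + l • (r0, r1)) (r0, r1) = wedge (q0, q1) (r0, r1) := by
    simp [wedge]; ring
  have e4 : wedge (twist d x y ((p0, p1) + l • (q0, q1) + (l ^ 2 / 2) • (r0, r1)))
      ((q0, q1) + l • (r0, r1)) = wedge (twist d x y (p0, p1)) (q0, q1) +
      l * wedge (twist d x y (p0, p1)) (r0, r1) +
      l ^ 2 / 2 * wedge (twist d x y (q0, q1)) (r0, r1) +
      l * (y * ((q0 + l / 2 * r0) ^ 2 + d * (q1 + l / 2 * r1) ^ 2)) +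
      l ^ 3 / 4 * (y * (r0 ^ 2 + d * r1 ^ 2)) := by
    simp [wedge, twist]; ring
  have e5 : wedge (twist d x y ((p0, p1) + l • (q0, q1) + (l ^ 2 / 2) • (r0, r1))) (r0, r1) =
      wedge (twist d x y (p0, p1)) (r0, r1) + l * wedge (twist d x y (q0, q1)) (r0, r1) +
      l ^ 2 / 2 * (y * (r0 ^ 2 + d * r1 ^ 2)) := by
    simp [wedge, twist]; ring
  have e6 : wedge (twist d x y ((q0, q1) + l • (r0, r1))) (r0, r1) =
      wedge (twist d x y (q0, q1)) (r0, r1) + l * (y * (r0 ^ 2 + d * r1 ^ 2)) := by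
    simp [wedge, twist]; ring
  have M : 0 ≤ y * ((q0 + l / 2 * r0) ^ 2 + d * (q1 + l / 2 * r1) ^ 2) := by positivity
  refine ⟨⟨?_, ?_, ?_, ?_, ?_, ?_⟩, ?_⟩
  · rw [e1]; positivity
  · rw [e2]; positivity
  · rw [e3]; positivity
  · rw [e4]; positivity
  · rw [e5]; positivity
  · rw [e6]; positivity
  · rintro (⟨s1, s2, s3⟩ | ⟨hp, hq, hr⟩)
    · refine ⟨?_, ?_, ?_⟩
      · rw [e4]; positivity
      · rw [e5]; positivity
      · rw [e6]; positivity
    · obtain ⟨rfl, rfl⟩ := Prod.mk.inj hr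
      have N' : 0 < y * ((1 : ℝ) ^ 2 + d * 0 ^ 2) := by simpa using hy
      refine ⟨?_, ?_, ?_⟩
      · rw [e4]; positivity
      · rw [e5]; positivity
      · rw [e6]; positivity

/-- Twisting both arguments multiplies `wedge` by the norm x² + d y². Hence the untwisted form of p,
q feeds the twisted form of q, r, while the twisted form of p, q feeds the untwisted one; this is
why both families are carried along. -/
theorem Interlacing.jump {d x y G : ℝ} {p q r : ℝ × ℝ} (hd : 0 ≤ d) (hy : 0 < y)
    (hG : 0 ≤ G) (h : Interlacing d x y p q r) :
    Interlacing d x y p q (r - G • twist d x y p) ∧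
    (StrictInterlacing d x y p q r → StrictInterlacing d x y p q (r - G • twist d x y p)) := by
  obtain ⟨p0, p1⟩ := p
  obtain ⟨q0, q1⟩ := q
  obtain ⟨r0, r1⟩ := r
  obtain ⟨h1, h2, h3, h4, h5, h6⟩ := h
  have N : 0 ≤ y * (p0 ^ 2 + d * p1 ^ 2) := by positivity
  have e2 : wedge (p0, p1) ((r0, r1) - G • twist d x y (p0, p1)) = wedge (p0, p1) (r0, r1) +
      G * (y * (p0 ^ 2 + d * p1 ^ 2)) := by
    simp [wedge, twist]; ring
  have e3 : wedge (q0, q1) ((r0, r1) - G • twist d x y (p0, p1)) = wedge (q0, q1) (r0, r1) +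
      G * wedge (twist d x y (p0, p1)) (q0, q1) := by
    simp [wedge, twist]; ring
  have e5 : wedge (twist d x y (p0, p1)) ((r0, r1) - G • twist d x y (p0, p1)) =
      wedge (twist d x y (p0, p1)) (r0, r1) := by
    simp [wedge, twist]; ring
  have e6 : wedge (twist d x y (q0, q1)) ((r0, r1) - G • twist d x y (p0, p1)) =
      wedge (twist d x y (q0, q1)) (r0, r1) +
      G * ((x ^ 2 + d * y ^ 2) * wedge (p0, p1) (q0, q1)) := by
    simp [wedge, twist]; ring
  refine ⟨⟨h1, ?_, ?_, h4, ?_, ?_⟩, fun ⟨s1, s2, s3⟩ => ⟨s1, ?_, ?_⟩⟩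
  · rw [e2]; positivity
  · rw [e3]; positivity
  · rw [e5]; positivity
  · rw [e6]; positivity
  · rw [e5]; positivity
  · rw [e6]; positivity

theorem strictInterlacing_one (S : CubicString n) {d x y : ℝ} (hd : 0 ≤ d) (hy : 0 < y)
    {u : ℝ → Fin 3 → ℝ × ℝ} (h0 : u 0 = ![0, 0, (1, 0)])
    (hs : ∀ a b, S.IsGap a b →
      u b 0 = u a 0 + (b - a) • u a 1 + ((b - a) ^ 2 / 2) • u a 2 ∧
      u b 1 = u a 1 + (b - a) • u a 2 ∧
      u b 2 = u a 2 - S.massAt b • twist d x y (u b 0)) :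
    StrictInterlacing d x y (u 1 0) (u 1 1) (u 1 2) := by
  -- The data at 0 interlace only weakly; strictness begins with the first gap, hence the
  -- alternative `s = 0`.
  refine ((S.string_induction (P := fun s => Interlacing d x y (u s 0) (u s 1) (u s 2) ∧
    (StrictInterlacing d x y (u s 0) (u s 1) (u s 2) ∨ s = 0)) ?_ ?_) 1 (by simp)).2.resolve_right
      one_ne_zero
  · refine ⟨?_, Or.inr rfl⟩
    constructor <;> simp [h0, wedge, twist]
  · rintro a b hab ⟨hi, hst⟩
    obtain ⟨e0, e1, e2⟩ := hs a b hab
    obtain ⟨k1, k2⟩ := hi.propagate hd hy (sub_pos.2 hab.lt)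
    have k3 := k2 (hst.imp_right fun h => by simp [h, h0])
    obtain ⟨m1, m2⟩ := k1.jump hd hy (S.massAt_nonneg b)
    rw [← e1, ← e0, ← e2] at m1 m2
    rw [← e1, ← e0] at k3
    exact ⟨m1, Or.inl (m2 k3)⟩

/-- Case d = 1, twisting by z itself: a vanishing component would annihilate a strictly positive
form. -/
theorem phi_ne_zero_of_im_pos (S : CubicString n) {z : ℂ} (hz : 0 < z.im) (j : Fin 3) :
    S.phi z 1 j ≠ 0 := by
  obtain ⟨hp, hi⟩ := S.phi_spec z
  have := S.strictInterlacing_one (d := 1) (x := z.re) (y := z.im) zero_le_one hz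
    (u := fun s j => ((S.phi z s j).re, (S.phi z s j).im)) (by
      ext j <;> fin_cases j <;> simp [hi]) (fun a b hab => by
      obtain ⟨e0, e1, e2⟩ := hp.step hab
      refine ⟨?_, ?_, ?_⟩
      · simp only [e0]; ext <;> simp [-Complex.ofReal_pow, -Complex.ofReal_sub, -Complex.ofReal_div]
      · simp only [e1]; ext <;> simp [-Complex.ofReal_pow, -Complex.ofReal_sub, -Complex.ofReal_div]
      · simp only [e2]; ext <;> simp [twist] <;> ring)
  obtain ⟨s1, s2, s3⟩ := this
  intro h
  fin_cases j
  · simp only [Fin.zero_eta] at h; simp [h, wedge, twist] at s1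
  · simp only [Fin.mk_one] at h; simp [h, wedge, twist] at s1
  · simp only [Fin.reduceFinMk] at h; simp [h, wedge, twist] at s2

/-! ### Polynomial dependence on the spectral parameter -/

theorem exists_phiPoly (S : CubicString n) : ∀ x ∈ Set.Icc (0 : ℝ) 1,
    ∃ Q : Fin 3 → ℝ[X], ∀ z j, S.phi z x j = aeval z (Q j) := by
  refine S.string_induction ⟨![0, 0, 1], fun z j => ?_⟩ fun a b hab ⟨Q, hQ⟩ => ?_
  · rw [(S.phi_spec z).2]
    fin_cases j <;> simp
  · set P := Q 0 + C (b - a) * Q 1 + C ((b - a) ^ 2 / 2) * Q 2 with hP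
    have h0 : ∀ z, S.phi z b 0 = aeval z P := fun z => by
      rw [((S.phi_spec z).1.step hab).1]; simp [hP, hQ]
    refine ⟨![P, Q 1 + C (b - a) * Q 2, Q 2 - X * C (S.massAt b) * P], fun z j => ?_⟩
    obtain ⟨e0, e1, e2⟩ := (S.phi_spec z).1.step hab
    fin_cases j
    · exact h0 z
    · simp only [Fin.mk_one]; rw [e1]; simp [hQ]
    · simp only [Fin.reduceFinMk]; rw [e2, h0]; simp [hQ]; ring

/-- The solution `φ` and its derivatives, as polynomials in the spectral parameter. -/
def phiPoly (S : CubicString n) (x : ℝ) : Fin 3 → ℝ[X] :=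
  open Classical in
  if h : x ∈ Set.Icc (0 : ℝ) 1 then (S.exists_phiPoly x h).choose else 0

theorem phi_eq_aeval (S : CubicString n) {x : ℝ} (hx : x ∈ Set.Icc (0 : ℝ) 1) (z : ℂ)
    (j : Fin 3) : S.phi z x j = aeval z (S.phiPoly x j) := by
  rw [phiPoly, dif_pos hx]
  exact (S.exists_phiPoly x hx).choose_spec z j

theorem poly_ext_complex {P Q : ℝ[X]} (h : ∀ z : ℂ, aeval z P = aeval z Q) : P = Q := by
  refine Polynomial.funext fun x => ?_
  have := h x
  rw [← Complex.coe_algebraMap, aeval_algebraMap_apply, aeval_algebraMap_apply] at this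
  simpa using this

theorem phiPoly_zero (S : CubicString n) : S.phiPoly 0 = ![0, 0, 1] := by
  funext j
  refine poly_ext_complex fun z => ?_
  rw [← S.phi_eq_aeval (by simp), (S.phi_spec z).2]
  fin_cases j <;> simp

theorem phiPoly_step (S : CubicString n) {a b : ℝ} (hab : S.IsGap a b) :
    S.phiPoly b 0 = S.phiPoly a 0 + C (b - a) * S.phiPoly a 1 +
      C ((b - a) ^ 2 / 2) * S.phiPoly a 2 ∧
    S.phiPoly b 1 = S.phiPoly a 1 + C (b - a) * S.phiPoly a 2 ∧
    S.phiPoly b 2 = S.phiPoly a 2 - C (S.massAt b) * (X * S.phiPoly b 0) := by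
  refine ⟨poly_ext_complex fun z => ?_, poly_ext_complex fun z => ?_,
    poly_ext_complex fun z => ?_⟩ <;> obtain ⟨e0, e1, e2⟩ := (S.phi_spec z).1.step hab
  · simpa [← S.phi_eq_aeval hab.mem_left, ← S.phi_eq_aeval hab.mem_right] using e0
  · simpa [← S.phi_eq_aeval hab.mem_left, ← S.phi_eq_aeval hab.mem_right] using e1
  · simp only [map_sub, map_mul, aeval_C, aeval_X, ← S.phi_eq_aeval hab.mem_left,
      ← S.phi_eq_aeval hab.mem_right, e2]
    simp
    ring

/-- Case d = 0, y = 1: on pairs (value, derivative) at x, multiplication by x + δ is multiplication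
of polynomials by `X`, by the product rule. -/
theorem strictInterlacing_phiPoly (S : CubicString n) (x : ℝ) :
    StrictInterlacing 0 x 1
      ((S.phiPoly 1 0).eval x, (derivative (S.phiPoly 1 0)).eval x)
      ((S.phiPoly 1 1).eval x, (derivative (S.phiPoly 1 1)).eval x)
      ((S.phiPoly 1 2).eval x, (derivative (S.phiPoly 1 2)).eval x) := by
  refine S.strictInterlacing_one le_rfl one_pos
    (u := fun s j => ((S.phiPoly s j).eval x, (derivative (S.phiPoly s j)).eval x)) ?_
    fun a b hab => ?_
  · ext j <;> fin_cases j <;> simp [phiPoly_zero]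
  · obtain ⟨e0, e1, e2⟩ := S.phiPoly_step hab
    refine ⟨?_, ?_, ?_⟩
    · simp only [e0]; ext <;> simp
    · simp only [e1]; ext <;> simp
    · simp only [e2]
      ext
      · simp [twist]
      · simp only [twist, derivative_sub, derivative_mul, derivative_C, derivative_X, eval_sub,
          eval_add, eval_mul, eval_C, eval_X, Prod.snd_sub, Prod.smul_snd, smul_eq_mul]
        simp only [eval_zero, eval_one]
        ring

theorem phi_conj (S : CubicString n) (z : ℂ) (j : Fin 3) :
    S.phi ((starRingEnd ℂ) z) 1 j = (starRingEnd ℂ) (S.phi z 1 j) := by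
  rw [S.phi_eq_aeval (by simp), S.phi_eq_aeval (by simp)]
  exact aeval_conj _ _

/-- For a nonpositive parameter the jumps of φ_ξξ are nonnegative, so positivity spreads from the
initial data. The alternative at 0 covers the vanishing of φ and φ_ξ there. -/
theorem phiPoly_eval_pos (S : CubicString n) {x : ℝ} (hx : x ≤ 0) (j : Fin 3) :
    0 < (S.phiPoly 1 j).eval x := by
  have := S.string_induction (P := fun s => (s = 0 ∨ 0 < (S.phiPoly s 0).eval x ∧
    0 < (S.phiPoly s 1).eval x) ∧ 0 < (S.phiPoly s 2).eval x) ?_ ?_ 1 (by simp)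
  · obtain ⟨h | ⟨h0, h1⟩, h2⟩ := this
    · exact absurd h one_ne_zero
    · fin_cases j <;> assumption
  · simp [phiPoly_zero]
  · rintro a b hab ⟨h01, h2⟩
    obtain ⟨e0, e1, e2⟩ := S.phiPoly_step hab
    have hl := sub_pos.2 hab.lt
    have h0 : 0 ≤ (S.phiPoly a 0).eval x := by
      rcases h01 with rfl | h
      · simp [phiPoly_zero]
      · exact h.1.le
    have h1 : 0 ≤ (S.phiPoly a 1).eval x := by
      rcases h01 with rfl | h
      · simp [phiPoly_zero]
      · exact h.2.le
    have h0' : 0 < (S.phiPoly b 0).eval x := by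
      rw [e0]; simp only [eval_add, eval_mul, eval_C]; positivity
    have h1' : 0 < (S.phiPoly b 1).eval x := by
      rw [e1]; simp only [eval_add, eval_mul, eval_C]; positivity
    refine ⟨Or.inr ⟨h0', h1'⟩, ?_⟩
    rw [e2]
    simp only [eval_sub, eval_mul, eval_C, eval_X]
    have := mul_nonneg (S.massAt_nonneg b) (mul_nonneg (neg_nonneg.2 hx) h0'.le)
    linarith

theorem phi_ofReal (S : CubicString n) (x : ℝ) (j : Fin 3) :
    S.phi x 1 j = ((S.phiPoly 1 j).eval x : ℝ) := by
  rw [S.phi_eq_aeval (by simp), ← Complex.coe_algebraMap, aeval_algebraMap_apply]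
  simp

theorem deriv_phi (S : CubicString n) (z : ℂ) (j : Fin 3) :
    deriv (fun y => S.phi y 1 j) z = aeval z (derivative (S.phiPoly 1 j)) := by
  have : (fun y => S.phi y 1 j) = fun y => aeval y (S.phiPoly 1 j) :=
    funext fun y => S.phi_eq_aeval (by simp) y j
  rw [this]
  exact Polynomial.deriv_aeval _

theorem deriv_phi_ofReal (S : CubicString n) (x : ℝ) (j : Fin 3) :
    deriv (fun y => S.phi y 1 j) x = ((derivative (S.phiPoly 1 j)).eval x : ℝ) := by
  rw [deriv_phi, ← Complex.coe_algebraMap, aeval_algebraMap_apply]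
  simp

/-! ### Positivity of eigenvalues and weights -/

theorem exists_pos_of_mem_spectrum (S : CubicString n) {a : Fin 3} {z : ℂ}
    (hz : z ∈ S.spectrum a) : ∃ x : ℝ, 0 < x ∧ z = x ∧ (S.phiPoly 1 a).eval x = 0 := by
  rw [mem_spectrum_iff] at hz
  have him : z.im = 0 := by
    rcases lt_trichotomy z.im 0 with h | h | h
    -- Real coefficients reflect a zero in the lower half-plane to one in the upper.
    · refine absurd ?_ (S.phi_ne_zero_of_im_pos (z := (starRingEnd ℂ) z) (by simpa using h) a)
      rw [phi_conj, hz, map_zero]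
    · exact h
    · exact absurd hz (S.phi_ne_zero_of_im_pos h a)
  have hx : z = (z.re : ℂ) := Complex.ext rfl (by simp [him])
  rw [hx, phi_ofReal, Complex.ofReal_eq_zero] at hz
  refine ⟨z.re, ?_, hx, hz⟩
  by_contra! h
  exact (S.phiPoly_eval_pos h a).ne' hz

theorem weight_ofReal (S : CubicString n) (a : Fin 3) {N : ℂ → ℂ} {x v : ℝ} (hN : N x = v) :
    S.weight a N x = (v / (derivative (S.phiPoly 1 a)).eval x : ℝ) := by
  rw [weight, hN, deriv_phi_ofReal, Complex.ofReal_div]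

theorem weight_numA_pos (S : CubicString n) (T : TypePair) {x : ℝ} (hx : 0 < x)
    (h : (S.phiPoly 1 T.fst).eval x = 0) :
    ∃ A : ℝ, 0 < A ∧ S.weight T.fst (T.numA S) x = A := by
  obtain ⟨s1, s2, s3⟩ := S.strictInterlacing_phiPoly x
  have key : ∀ v w : ℝ, 0 < x * (w * v) → 0 < v / w := fun v w h => by
    have := pos_of_mul_pos_right h hx.le
    rcases pos_and_pos_or_neg_and_neg_of_mul_pos this with ⟨h1, h2⟩ | ⟨h1, h2⟩
    · exact div_pos h2 h1
    · exact div_pos_of_neg_of_neg h2 h1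
  -- At an eigenvalue one component vanishes, and the form pairing it with the numerator's component
  -- reduces to x times derivative times numerator, the sign being part of the numerator.
  cases T <;> simp only [TypePair.fst] at h ⊢ <;> simp only [wedge, twist, h] at s1 s2 s3
  · exact ⟨_, key _ _ (by linarith), S.weight_ofReal 0 (S.phi_ofReal x 1)⟩
  · exact ⟨_, key _ _ (by linarith), S.weight_ofReal 0 (S.phi_ofReal x 2)⟩
  · exact ⟨_, key _ _ (by linarith), S.weight_ofReal 1 (S.phi_ofReal x 2)⟩
  · exact ⟨_, key _ _ (by linarith), S.weight_ofReal 2 (v := -(S.phiPoly 1 1).eval x)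
      (by simp [TypePair.numA, S.phi_ofReal])⟩

theorem weight_numB_pos (S : CubicString n) (T : TypePair) {x : ℝ} (hx : 0 < x)
    (h : (S.phiPoly 1 T.snd).eval x = 0) :
    ∃ A : ℝ, 0 < A ∧ S.weight T.snd (T.numB S) x = A := by
  obtain ⟨s1, s2, s3⟩ := S.strictInterlacing_phiPoly x
  have key : ∀ v w : ℝ, 0 < x * (w * v) → 0 < v / w := fun v w h => by
    have := pos_of_mul_pos_right h hx.le
    rcases pos_and_pos_or_neg_and_neg_of_mul_pos this with ⟨h1, h2⟩ | ⟨h1, h2⟩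
    · exact div_pos h2 h1
    · exact div_pos_of_neg_of_neg h2 h1
  cases T <;> simp only [TypePair.snd] at h ⊢ <;> simp only [wedge, twist, h] at s1 s2 s3
  · exact ⟨_, key _ _ (by linarith), S.weight_ofReal 0 (S.phi_ofReal x 1)⟩
  · exact ⟨_, key _ _ (by linarith), S.weight_ofReal 1 (v := -(S.phiPoly 1 0).eval x)
      (by simp [TypePair.numB, S.phi_ofReal])⟩
  · exact ⟨_, key _ _ (by linarith), S.weight_ofReal 2 (v := -(S.phiPoly 1 0).eval x)
      (by simp [TypePair.numB, S.phi_ofReal])⟩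
  · exact ⟨_, key _ _ (by linarith), S.weight_ofReal 2 (v := -(S.phiPoly 1 1).eval x)
      (by simp [TypePair.numB, S.phi_ofReal])⟩

theorem phiPoly_ne_zero (S : CubicString n) (a : Fin 3) : S.phiPoly 1 a ≠ 0 := by
  intro h
  simpa [h] using S.phiPoly_eval_pos le_rfl a

theorem finite_spectrum (S : CubicString n) (a : Fin 3) : (S.spectrum a).Finite := by
  refine ((S.phiPoly 1 a).rootSet_finite ℂ).subset fun z hz => ?_
  rw [mem_rootSet]
  exact ⟨S.phiPoly_ne_zero a, by rw [← S.phi_eq_aeval (by simp), ← mem_spectrum_iff]; exact hz⟩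

/-! ### Degrees from triangular recursions -/

/-- Only the last summand reaches degree m - 1, and the factor `X` raises it to m; the constant
matters only for m = 0. -/
theorem degree_step {m : ℕ} (p : ℕ → ℝ[X]) (hp : ∀ k < m, (p k).degree = k) (h : ℕ → ℝ)
    (hh : ∀ k, k + 1 = m → h k ≠ 0) (a : ℝ) (ha : m = 0 → a ≠ 0) :
    (C a + X * ∑ k ∈ Finset.range m, C (h k) * p k : ℝ[X]).degree = (m : WithBot ℕ) := by
  cases m with
  | zero => simpa using degree_C (ha rfl)
  | succ m =>
    have hlt : (∑ k ∈ Finset.range m, C (h k) * p k : ℝ[X]).degree < (m : WithBot ℕ) := by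
      rw [← Polynomial.mem_degreeLT]
      refine Submodule.sum_mem _ fun k hk => ?_
      have hk := Finset.mem_range.1 hk
      rw [C_mul']
      refine Submodule.smul_mem _ _ ?_
      rw [Polynomial.mem_degreeLT, hp k (by omega)]
      exact_mod_cast hk
    have htop : (C (h m) * p m).degree = m := by
      rw [degree_C_mul (hh m rfl), hp m (by omega)]
    have hsum : (∑ k ∈ Finset.range (m + 1), C (h k) * p k : ℝ[X]).degree =
        (m : WithBot ℕ) := by
      rw [Finset.sum_range_succ, degree_add_eq_right_of_degree_lt (by rwa [htop]), htop]
    have hX : (X * ∑ k ∈ Finset.range (m + 1), C (h k) * p k : ℝ[X]).degree =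
        ((m + 1 : ℕ) : WithBot ℕ) := by
      rw [degree_mul, hsum, degree_X, add_comm]; rfl
    rw [degree_add_eq_right_of_degree_lt, hX]
    rw [hX]
    exact degree_C_le.trans_lt (by exact_mod_cast m.succ_pos)

/-- Solutions of a triangular recursion are polynomials in the spectral parameter. -/
theorem exists_degree_eq {N : ℕ} (c : ℕ → ℂ → ℂ) (a : ℕ → ℝ) (K : ℕ → ℕ → ℝ) (ha : a 0 ≠ 0)
    (hK : ∀ j, j + 1 < N → K (j + 1) j ≠ 0)
    (hc : ∀ j < N, ∀ z, c j z = a j + z * ∑ k ∈ Finset.range j, K j k * c k z) :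
    ∀ j < N, ∃ p : ℝ[X], p.degree = (j : WithBot ℕ) ∧ ∀ z, c j z = aeval z p := by
  intro j
  induction j using Nat.strong_induction_on with
  | _ j ih =>
    intro hj
    have : ∀ k, ∃ p : ℝ[X], k < j → p.degree = (k : WithBot ℕ) ∧ ∀ z, c k z = aeval z p :=
      fun k => by
        by_cases hk : k < j
        · obtain ⟨p, hp⟩ := ih k hk (hk.trans hj)
          exact ⟨p, fun _ => hp⟩
        · exact ⟨0, fun h => absurd h hk⟩
    choose p hp using this
    refine ⟨_, degree_step p (fun k hk => (hp k hk).1) (K j) (fun k hk => ?_) (a j)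
      (fun h => h ▸ ha), fun z => ?_⟩
    · subst hk; exact hK k hj
    · rw [hc j hj]
      simp only [map_add, aeval_C, map_mul, aeval_X, map_sum]
      simp only [Complex.coe_algebraMap]
      congr 2
      exact Finset.sum_congr rfl fun k hk => by rw [(hp k (Finset.mem_range.1 hk)).2]

theorem sum_range_eq_sum_fin {j : ℕ} (hj : j ≤ n) (f : ℕ → ℂ) :
    ∑ k ∈ Finset.range j, f k = ∑ i : Fin n, if (i : ℕ) < j then f i else 0 := by
  rw [← Finset.sum_range (fun k => if k < j then f k else 0), ← Finset.sum_filter]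
  congr 1
  ext k
  simp only [Finset.mem_range, Finset.mem_filter]
  omega

theorem exists_phi_degree (S : CubicString n) (i : Fin n) :
    ∃ p : ℝ[X], p.degree = ((i : ℕ) : WithBot ℕ) ∧
      ∀ z, S.phi z (S.pos i) 0 = aeval z p := by
  have h := exists_degree_eq (N := n)
    (fun j z => if h : j < n then S.phi z (S.pos ⟨j, h⟩) 0 else 0)
    -- The default 1 keeps the constant at index 0 nonzero even for `n = 0`.
    (fun j => if h : j < n then S.pos ⟨j, h⟩ ^ 2 / 2 else 1)
    (fun j k => if h : j < n ∧ k < n then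
      -(S.mass ⟨k, h.2⟩ * ((S.pos ⟨j, h.1⟩ - S.pos ⟨k, h.2⟩) ^ 2 / 2)) else 0) ?_ ?_ ?_ i i.2
  · simpa using h
  · split_ifs
    · have := S.pos_pos ⟨0, ‹_›⟩
      positivity
    · exact one_ne_zero
  · intro j hj
    have hj' : j < n := by omega
    have h1 := S.mass_pos ⟨j, hj'⟩
    have h2 : 0 < S.pos ⟨j + 1, hj⟩ - S.pos ⟨j, hj'⟩ :=
      sub_pos.2 (S.pos_strictMono (Fin.mk_lt_mk.2 j.lt_succ_self))
    simp only [hj, hj', and_self, dite_true]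
    exact neg_ne_zero.2 (by positivity)
  · intro j hj z
    rw [sum_range_eq_sum_fin hj.le]
    obtain ⟨hp, hi⟩ := S.phi_spec z
    simp only [hj, true_and, dite_true, Fin.is_lt, Fin.eta]
    rw [hp.eq_ansatz (S.pos_mem _)]
    simp only [ansatz, Matrix.cons_val, hi, Finset.mul_sum]
    congr 1
    · simp
    · refine Finset.sum_congr rfl fun k _ => ?_
      by_cases hk : (k : ℕ) < j
      · rw [if_pos (S.pos_strictMono.monotone (Fin.mk_le_mk.2 hk.le)), if_pos hk]
        push_cast
        ring
      · rw [if_neg hk, mul_zero]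
        split_ifs with h
        · have : k = ⟨j, hj⟩ := le_antisymm (S.pos_strictMono.le_iff_le.1 h)
            (Fin.mk_le_mk.2 (not_lt.1 hk))
          simp [this]
        · simp

theorem degree_phiPoly_one (S : CubicString n) {a : Fin 3} (ha : a = 2 ∨ ∀ i, S.pos i < 1) :
    (S.phiPoly 1 a).degree = (n : WithBot ℕ) := by
  choose p hp using S.exists_phi_degree
  set h : Fin n → ℝ := fun i => -(S.mass i * (![(1 - S.pos i) ^ 2 / 2, 1 - S.pos i, 1] : Fin 3 → ℝ) a)
    with hh
  set c : ℝ := (![1 / 2, 1, 1] : Fin 3 → ℝ) a with hc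
  have key : S.phiPoly 1 a = C c + X * ∑ k ∈ Finset.range n,
      C (if hk : k < n then h ⟨k, hk⟩ else 0) * (if hk : k < n then p ⟨k, hk⟩ else 0) := by
    refine poly_ext_complex fun z => ?_
    rw [Finset.sum_range, ← S.phi_eq_aeval (by simp)]
    obtain ⟨hs, hi⟩ := S.phi_spec z
    rw [hs.eq_ansatz (by simp)]
    simp only [Fin.is_lt, dite_true, Fin.eta, map_add, map_mul, map_sum, aeval_C, aeval_X,
      ← (hp _).2, Finset.mul_sum, Complex.coe_algebraMap]
    fin_cases a <;> simp only [ansatz, Fin.zero_eta, Fin.mk_one, Fin.reduceFinMk, Matrix.cons_val,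
      hi, S.pos_le_one, if_true, hc, hh] <;> congr 1
    · simp
    · refine Finset.sum_congr rfl fun k _ => ?_
      push_cast
      ring
    · simp
    · refine Finset.sum_congr rfl fun k _ => ?_
      push_cast
      ring
    · refine Finset.sum_congr rfl fun k _ => ?_
      push_cast
      ring
  rw [key]
  refine degree_step (fun k => if hk : k < n then p ⟨k, hk⟩ else 0) (fun k hk => ?_)
    (fun k => if hk : k < n then h ⟨k, hk⟩ else 0) (fun k hk => ?_) c fun _ => ?_
  · simpa only [hk, dite_true] using (hp ⟨k, hk⟩).1
  · have hk' : k < n := by omega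
    simp only [hk', dite_true, hh]
    refine neg_ne_zero.2 (mul_ne_zero (S.mass_pos _).ne' ?_)
    -- For types 0 and 1 the coefficient carries a power of 1 - ξ_k, which would vanish for a mass
    -- at the end point.
    rcases ha with rfl | ha
    · simp
    · have := sub_pos.2 (ha ⟨k, hk'⟩)
      fin_cases a
      · simpa using this.ne'
      · simpa using this.ne'
      · simp
  · rw [hc]; fin_cases a <;> simp

theorem Solves.eq_right {S : CubicString n} {w : ℂ} {u : ℝ → Fin 3 → ℂ} (h : S.Solves w u)
    {x : ℝ} (hx : x ∈ Set.Icc (0 : ℝ) 1) :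
    u x 0 = u 1 0 + u 1 1 * (x - 1 : ℝ) + u 1 2 * ((x - 1) ^ 2 / 2 : ℝ) -
      w * ∑ k, S.mass k * u (S.pos k) 0 *
        (if S.pos k ≤ x then 0 else (((x - S.pos k) ^ 2 / 2 : ℝ) : ℂ)) := by
  rw [h.eq_ansatz hx, h.eq_ansatz (x := 1) (by simp) 0, h.eq_ansatz (x := 1) (by simp) 1,
    h.eq_ansatz (x := 1) (by simp) 2]
  simp only [ansatz, Matrix.cons_val, S.pos_le_one, if_true]
  have h1 : ∀ k, w * S.mass k * u (S.pos k) 0 *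
      (if S.pos k ≤ x then (((x - S.pos k) ^ 2 / 2 : ℝ) : ℂ) else 0) =
      w * S.mass k * u (S.pos k) 0 * (((1 - S.pos k) ^ 2 / 2 : ℝ) : ℂ)
      + (w * S.mass k * u (S.pos k) 0 * ((1 - S.pos k : ℝ) : ℂ)) * (x - 1 : ℝ)
      + (w * S.mass k * u (S.pos k) 0 * 1) * ((x - 1) ^ 2 / 2 : ℝ)
      - w * (S.mass k * u (S.pos k) 0 * (if S.pos k ≤ x then 0 else
        (((x - S.pos k) ^ 2 / 2 : ℝ) : ℂ))) := by
    intro k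
    split_ifs <;> push_cast <;> ring
  simp only [h1, Finset.sum_add_distrib, Finset.sum_sub_distrib, ← Finset.sum_mul,
    ← Finset.mul_sum]
  push_cast
  ring

/-- Integrating leftwards from 1, the value at a mass involves only the masses to its right, so
counting from the right makes the recursion triangular. For types 0 and 1 its initial constant would
vanish if the last mass sat at 1. -/
theorem exists_phiStar_degree (S : CubicString n) {a : Fin 3} (ha : a = 2 ∨ ∀ i, S.pos i < 1)
    (j : Fin n) : ∃ p : ℝ[X], p.degree = ((j : ℕ) : WithBot ℕ) ∧
      ∀ z, S.phiStar a z (S.pos j.rev) 0 = aeval z p := by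
  have h := exists_degree_eq (N := n)
    (fun j z => if h : j < n then S.phiStar a z (S.pos (Fin.rev ⟨j, h⟩)) 0 else 0)
    (fun j => if h : j < n then (![(S.pos (Fin.rev ⟨j, h⟩) - 1) ^ 2 / 2,
      S.pos (Fin.rev ⟨j, h⟩) - 1, 1] : Fin 3 → ℝ) a else 1)
    (fun j k => if h : j < n ∧ k < n then -(S.mass (Fin.rev ⟨k, h.2⟩) *
      ((S.pos (Fin.rev ⟨j, h.1⟩) - S.pos (Fin.rev ⟨k, h.2⟩)) ^ 2 / 2)) else 0) ?_ ?_ ?_ j j.2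
  · simpa using h
  · split_ifs with h0
    · rcases ha with rfl | ha
      · simp
      · have := (sub_neg.2 (ha (Fin.rev ⟨0, h0⟩))).ne
        fin_cases a
        · simpa using this
        · simpa using this
        · simp
    · exact one_ne_zero
  · intro j hj
    have hj' : j < n := by omega
    have h1 := S.mass_pos (Fin.rev ⟨j, hj'⟩)
    have h2 : S.pos (Fin.rev ⟨j + 1, hj⟩) - S.pos (Fin.rev ⟨j, hj'⟩) < 0 :=
      sub_neg.2 (S.pos_strictMono (Fin.rev_lt_rev.2 (Fin.mk_lt_mk.2 j.lt_succ_self)))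
    simp only [hj, hj', and_self, dite_true]
    exact neg_ne_zero.2 (mul_ne_zero h1.ne' (div_ne_zero (pow_ne_zero 2 h2.ne) two_ne_zero))
  · intro j hj z
    rw [sum_range_eq_sum_fin hj.le]
    obtain ⟨hp, hi⟩ := S.phiStar_spec a z
    simp only [hj, true_and, dite_true, Fin.is_lt, Fin.eta]
    rw [hp.eq_right (S.pos_mem _), ← Equiv.sum_comp Fin.revPerm, sub_eq_add_neg, ← mul_neg,
      ← Finset.sum_neg_distrib]
    congr 1
    · simp only [hi]
      fin_cases a <;> simp [adjointInit]
    · congr 1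
      refine Finset.sum_congr rfl fun k _ => ?_
      simp only [Fin.revPerm_apply, S.pos_strictMono.le_iff_le, Fin.rev_le_rev]
      by_cases hk : (k : ℕ) < j
      · rw [if_neg (by rw [Fin.le_def]; simpa using hk), if_pos hk]
        push_cast
        ring
      · rw [if_neg hk, if_pos (by rw [Fin.le_def]; simpa using hk)]
        simp

theorem fourier_chi (S : CubicString n) (a : Fin 3) {ε : ℝ} (hε : 0 < ε)
    (hdisj : Pairwise fun i j => Disjoint (S.window ε i) (S.window ε j)) (j : Fin n) (z : ℂ) :
    S.fourier a (S.chi ε j) z =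
      (-1) ^ (a : ℕ) * (S.mass j.rev * S.phiStar a z (S.pos j.rev) 0) := by
  classical
  have hself : ∀ k : Fin n, S.pos k.rev ∈ S.window ε k := fun k =>
    ⟨by linarith, by linarith⟩
  have hchi : ∀ k, S.chi ε j (S.pos k) = if k = j.rev then 1 else 0 := by
    intro k
    split_ifs with h
    · rw [h, chi, Set.indicator_of_mem (hself j)]
    · rw [chi, Set.indicator_of_notMem]
      intro hm
      have hne : k.rev ≠ j := fun e => h (by rw [← e, Fin.rev_rev])
      have := hself k.rev
      rw [Fin.rev_rev] at this
      exact Set.disjoint_left.1 (hdisj hne) this hm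
  rw [fourier, setIntegral_g S _ _ measurableSet_Icc]
  simp only [S.pos_mem, if_true, hchi]
  simp

theorem exists_fourier_degree (S : CubicString n) {a : Fin 3} (ha : a = 2 ∨ ∀ i, S.pos i < 1)
    {ε : ℝ} (hε : 0 < ε) (hdisj : Pairwise fun i j => Disjoint (S.window ε i) (S.window ε j))
    (j : Fin n) : ∃ p : ℝ[X], p.degree = (j : ℕ) ∧
      ∀ z : ℂ, S.fourier a (S.chi ε j) z = aeval z p := by
  obtain ⟨p, hp, he⟩ := S.exists_phiStar_degree ha j
  refine ⟨C ((-1) ^ (a : ℕ) * S.mass j.rev) * p, ?_, fun z => ?_⟩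
  · rw [degree_C_mul, hp]
    exact mul_ne_zero (pow_ne_zero _ (by norm_num)) (S.mass_pos _).ne'
  · rw [S.fourier_chi a hε hdisj, he]
    simp [mul_assoc]

/-! ### Biorthogonality and completeness of eigenfunctions -/

/-- The Lagrange form equals (-1)^a φ^(a)(1; z) at the right end and φ*_a(0; w) at the left end. The
latter does not depend on z, so subtracting the case z = w removes it. -/
theorem sub_mul_sum_phi_phiStar (S : CubicString n) (a : Fin 3) (z w : ℂ) :
    (z - w) * ∑ i, S.mass i * (S.phi z (S.pos i) 0 * S.phiStar a w (S.pos i) 0) =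
      (-1) ^ (a : ℕ) * (S.phi w 1 a - S.phi z 1 a) := by
  have key : ∀ z, (-1) ^ (a : ℕ) * S.phi z 1 a = S.phiStar a w 0 0 + (-z + w) *
      ∑ i, S.mass i * (S.phi z (S.pos i) 0 * S.phiStar a w (S.pos i) 0) := fun z => by
    have h := (S.phi_spec z).1.lagrange_one (S.phiStar_spec a w).1
    rw [(S.phi_spec z).2, (S.phiStar_spec a w).2] at h
    simp only [Matrix.cons_val, zero_mul, sub_zero, add_zero, one_mul] at h
    rw [← h]
    fin_cases a <;> simp [adjointInit]
  have h1 := key w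
  have h2 := key z
  linear_combination h2 - h1

/-- The confluent case z → w of `sub_mul_sum_phi_phiStar`, obtained by differentiating at w. -/
theorem sum_phi_phiStar_self (S : CubicString n) (a : Fin 3) (w : ℂ) :
    ∑ i, S.mass i * (S.phi w (S.pos i) 0 * S.phiStar a w (S.pos i) 0) =
      -(-1) ^ (a : ℕ) * deriv (fun z => S.phi z 1 a) w := by
  set G : ℂ → ℂ := fun z =>
    ∑ i, S.mass i * (S.phi z (S.pos i) 0 * S.phiStar a w (S.pos i) 0) with hG
  have hd : DifferentiableAt ℂ G w := by
    refine DifferentiableAt.fun_sum fun i _ => ?_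
    simp only [S.phi_eq_aeval (S.pos_mem i)]
    exact ((Polynomial.differentiableAt_aeval _).mul_const _).const_mul _
  have hfun : (fun z => S.phi z 1 a) =
      fun z => S.phi w 1 a - (-1) ^ (a : ℕ) * ((z - w) * G z) := by
    funext z
    rw [hG, S.sub_mul_sum_phi_phiStar a z w, ← mul_assoc, ← mul_pow]
    simp
  have h1 := (((hasDerivAt_id w).sub_const w).mul hd.hasDerivAt).const_mul
    ((-1 : ℂ) ^ (a : ℕ)) |>.const_sub (S.phi w 1 a)
  have h2 : deriv (fun z => S.phi z 1 a) w = -((-1) ^ (a : ℕ) * G w) := by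
    rw [hfun]
    refine h1.deriv.trans ?_
    simp
  rw [h2, neg_mul_neg, ← mul_assoc, ← mul_pow]
  simp [hG]

/-- Simplicity of the eigenvalues: division by a zero derivative would give weight 0, but the weight
is positive. -/
theorem deriv_phi_ne_zero (S : CubicString n) (a : Fin 3) {z : ℂ} (hz : z ∈ S.spectrum a) :
    deriv (fun y => S.phi y 1 a) z ≠ 0 := by
  obtain ⟨x, hx, rfl, h⟩ := S.exists_pos_of_mem_spectrum hz
  have : ∃ T : TypePair, T.fst = a := by
    fin_cases a
    exacts [⟨.t00, rfl⟩, ⟨.t12, rfl⟩, ⟨.t22, rfl⟩]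
  obtain ⟨T, rfl⟩ := this
  obtain ⟨A, hA, hw⟩ := S.weight_numA_pos T hx h
  intro h0
  rw [weight, h0, div_zero] at hw
  exact hA.ne (by exact_mod_cast hw)

/-- The real eigenvalues of type `a`. -/
abbrev Eigenvalues (S : CubicString n) (a : Fin 3) : Type := {x : ℝ // (x : ℂ) ∈ S.spectrum a}

instance (S : CubicString n) (a : Fin 3) : Finite (S.Eigenvalues a) :=
  ((S.finite_spectrum a).preimage Complex.ofReal_injective.injOn).to_subtype

instance (S : CubicString n) (a : Fin 3) : Fintype (S.Eigenvalues a) := Fintype.ofFinite _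

theorem card_eigenvalues (S : CubicString n) {a : Fin 3} (ha : a = 2 ∨ ∀ i, S.pos i < 1) :
    Fintype.card (S.Eigenvalues a) = n := by
  classical
  set Q := (S.phiPoly 1 a).map (algebraMap ℝ ℂ) with hQ
  have hQ0 : Q ≠ 0 := (Polynomial.map_ne_zero_iff (algebraMap ℝ ℂ).injective).2
    (S.phiPoly_ne_zero a)
  have hroot : ∀ z, z ∈ Q.roots ↔ z ∈ S.spectrum a := fun z => by
    rw [mem_roots hQ0, IsRoot, hQ, eval_map_algebraMap, mem_spectrum_iff,
      S.phi_eq_aeval (by simp)]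
  have hcard : Q.roots.card = n := by
    rw [← (IsAlgClosed.splits Q).natDegree_eq_card_roots, hQ, natDegree_map,
      natDegree_eq_of_degree_eq_some (S.degree_phiPoly_one ha)]
  have hnodup : Q.roots.Nodup := by
    rw [Multiset.nodup_iff_count_le_one]
    -- A multiple root would also be a zero of the z-derivative.
    intro z
    rw [count_roots]
    by_contra! h
    obtain ⟨h1, h2⟩ := (one_lt_rootMultiplicity_iff_isRoot hQ0).1 h
    refine S.deriv_phi_ne_zero a ((hroot z).1 ((mem_roots hQ0).2 h1)) ?_
    rw [deriv_phi, ← eval_map_algebraMap, ← derivative_map]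
    exact h2
  rw [← Multiset.toFinset_card_of_nodup hnodup] at hcard
  refine Eq.trans ?_ hcard
  rw [← Fintype.card_coe]
  refine Fintype.card_congr (Equiv.ofBijective
    (fun x => ⟨(x.1 : ℂ), Multiset.mem_toFinset.2 ((hroot _).2 x.2)⟩) ⟨fun x y h => ?_, ?_⟩)
  · exact Subtype.ext (Complex.ofReal_injective (congrArg Subtype.val h))
  · rintro ⟨z, hz⟩
    have hz' := (hroot z).1 (Multiset.mem_toFinset.1 hz)
    obtain ⟨x, -, rfl, -⟩ := S.exists_pos_of_mem_spectrum hz'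
    exact ⟨⟨x, hz'⟩, rfl⟩

/-- Completeness of the eigenfunctions. -/
theorem sum_eigenvalues_phi_phiStar (S : CubicString n) {a : Fin 3}
    (ha : a = 2 ∨ ∀ i, S.pos i < 1) (i k : Fin n) :
    ∑ x : S.Eigenvalues a, S.phi (x : ℝ) (S.pos k) 0 *
      (S.mass i * S.phiStar a (x : ℝ) (S.pos i) 0) /
        deriv (fun y => S.phi y 1 a) ((x : ℝ) : ℂ) = -(-1) ^ (a : ℕ) * if k = i then 1 else 0 := by
  classical
  set M : Matrix (S.Eigenvalues a) (Fin n) ℂ := fun x i => S.phi (x : ℝ) (S.pos i) 0 with hM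
  set N : Matrix (Fin n) (S.Eigenvalues a) ℂ := fun i x =>
    (S.mass i * S.phiStar a (x : ℝ) (S.pos i) 0) /
      (-(-1) ^ (a : ℕ) * deriv (fun y => S.phi y 1 a) ((x : ℝ) : ℂ)) with hN
  have hsgn : (-(-1) ^ (a : ℕ) : ℂ) ≠ 0 := neg_ne_zero.2 (pow_ne_zero _ (by norm_num))
  have hMN : M * N = 1 := by
    ext x y
    rw [Matrix.mul_apply]
    have e : ∀ i, M x i * N i y = S.mass i * (S.phi (x : ℝ) (S.pos i) 0 *
        S.phiStar a (y : ℝ) (S.pos i) 0) /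
        (-(-1) ^ (a : ℕ) * deriv (fun y => S.phi y 1 a) ((y : ℝ) : ℂ)) := fun i => by
      simp only [hM, hN]; ring
    simp only [e, ← Finset.sum_div]
    by_cases hxy : x = y
    · subst hxy
      rw [Matrix.one_apply_eq, sum_phi_phiStar_self]
      exact div_self (mul_ne_zero hsgn (S.deriv_phi_ne_zero a x.2))
    · rw [Matrix.one_apply_ne hxy]
      have h := S.sub_mul_sum_phi_phiStar a (x : ℝ) (y : ℝ)
      rw [(S.mem_spectrum_iff a _).1 x.2, (S.mem_spectrum_iff a _).1 y.2, sub_zero, mul_zero] at h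
      have hne : ((x : ℝ) : ℂ) - ((y : ℝ) : ℂ) ≠ 0 :=
        sub_ne_zero.2 fun h => hxy (Subtype.ext (Complex.ofReal_injective h))
      rw [(mul_eq_zero.1 h).resolve_left hne, zero_div]
  have hNM : N * M = 1 := by
    -- As many eigenvalues as masses: the one-sided inverse is two-sided.
    refine (Matrix.mul_eq_one_comm_of_card_eq _ _ _ ?_).1 hMN
    rw [S.card_eigenvalues ha, Fintype.card_fin]
  have h := congrFun (congrFun hNM i) k
  rw [Matrix.mul_apply, Matrix.one_apply] at h
  simp only [eq_comm (a := k)]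
  rw [← h, Finset.mul_sum]
  refine Finset.sum_congr rfl fun x _ => ?_
  simp only [hM, hN]
  have := S.deriv_phi_ne_zero a x.2
  field_simp

/-- Inversion for the transform of χ_j: the sign (-1)^a in its definition makes the result
independent of the type. -/
theorem sum_eigenvalues_phi_fourier (S : CubicString n) {a : Fin 3}
    (ha : a = 2 ∨ ∀ i, S.pos i < 1) {ε : ℝ} (hε : 0 < ε)
    (hdisj : Pairwise fun i j => Disjoint (S.window ε i) (S.window ε j)) (j k : Fin n) :
    ∑ x : S.Eigenvalues a, S.phi (x : ℝ) (S.pos k) 0 * S.fourier a (S.chi ε j) (x : ℝ) /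
        deriv (fun y => S.phi y 1 a) ((x : ℝ) : ℂ) = -if k = j.rev then 1 else 0 := by
  have h := S.sum_eigenvalues_phi_phiStar ha j.rev k
  have hs : ((-1 : ℂ) ^ (a : ℕ)) * (-1) ^ (a : ℕ) = 1 := by rw [← mul_pow]; simp
  calc _ = (-1) ^ (a : ℕ) * ∑ x : S.Eigenvalues a, S.phi (x : ℝ) (S.pos k) 0 *
      (S.mass j.rev * S.phiStar a (x : ℝ) (S.pos j.rev) 0) /
        deriv (fun y => S.phi y 1 a) ((x : ℝ) : ℂ) := by
        rw [Finset.mul_sum]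
        refine Finset.sum_congr rfl fun x _ => ?_
        rw [S.fourier_chi a hε hdisj]
        ring
    _ = _ := by
        rw [h]
        linear_combination (-if k = j.rev then 1 else 0) * hs

/-! ### Evaluation of the pairing -/

/-- Positivity of the weights is essential: the measure is built from real parts truncated at 0,
which lose nothing only for positive real weights. -/
theorem integral_spectralMeasure (S : CubicString n) (a : Fin 3) (N : ℂ → ℂ)
    (hN : ∀ x : S.Eigenvalues a, ∃ A : ℝ, 0 < A ∧ S.weight a N (x : ℝ) = A) (f : ℝ → ℂ) :
    ∫ x, f x ∂(S.spectralMeasure a N) =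
      ∑ x : S.Eigenvalues a, S.weight a N (x : ℝ) * f x := by
  rw [spectralMeasure, Measure.sum_fintype, integral_finsetSum_measure]
  · refine Finset.sum_congr rfl fun x _ => ?_
    obtain ⟨A, hA, hw⟩ := hN x
    rw [integral_smul_measure, integral_dirac, hw, Complex.ofReal_re,
      ENNReal.toReal_ofReal hA.le, Complex.real_smul]
  · intro x _
    exact (integrable_dirac (by simp)).smul_measure ENNReal.ofReal_ne_top

/-- Of the three boundary terms at 1 in the Lagrange identity for φ(·; x) and φ(·; y), exactly the
product of the two numerators survives, up to sign; this singles out the four pairs of types. -/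
theorem numA_mul_numB (S : CubicString n) (T : TypePair) {x y : ℂ} (hx : x ∈ S.spectrum T.fst)
    (hy : y ∈ S.spectrum T.snd) :
    T.numA S x * T.numB S y =
      (x + y) * ∑ k, S.mass k * (S.phi x (S.pos k) 0 * S.phi y (S.pos k) 0) := by
  rw [mem_spectrum_iff] at hx hy
  have h := (S.phi_spec x).1.lagrange_one (S.phi_spec y).1
  rw [(S.phi_spec x).2, (S.phi_spec y).2] at h
  simp only [Matrix.cons_val, zero_mul, sub_zero, add_zero, mul_zero, zero_add] at h
  cases T <;> simp only [TypePair.fst, TypePair.snd] at hx hy <;>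
    simp only [TypePair.numA, TypePair.numB] <;> rw [hx, hy] at h <;> linear_combination -h

theorem weight_numA (S : CubicString n) (T : TypePair) (x : S.Eigenvalues T.fst) :
    ∃ A : ℝ, 0 < A ∧ S.weight T.fst (T.numA S) (x : ℝ) = A := by
  obtain ⟨y, hy, he, h⟩ := S.exists_pos_of_mem_spectrum x.2
  rw [he]
  exact S.weight_numA_pos T hy h

theorem weight_numB (S : CubicString n) (T : TypePair) (x : S.Eigenvalues T.snd) :
    ∃ A : ℝ, 0 < A ∧ S.weight T.snd (T.numB S) (x : ℝ) = A := by
  obtain ⟨y, hy, he, h⟩ := S.exists_pos_of_mem_spectrum x.2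
  rw [he]
  exact S.weight_numB_pos T hy h

theorem pairing_fourier (S : CubicString n) (T : TypePair)
    (hT : (∀ i, S.pos i < 1) ∨ T = TypePair.t22) {ε : ℝ} (hε : 0 < ε)
    (hdisj : Pairwise fun i j => Disjoint (S.window ε i) (S.window ε j)) (i j : Fin n) :
    S.pairing T (S.fourier T.fst (S.chi ε i)) (S.fourier T.snd (S.chi ε j)) =
      if i = j then (S.mass i.rev : ℂ) else 0 := by
  have ha : T.fst = 2 ∨ ∀ i, S.pos i < 1 := hT.symm.imp_left fun h => by rw [h]; rfl
  have hb : T.snd = 2 ∨ ∀ i, S.pos i < 1 := hT.symm.imp_left fun h => by rw [h]; rfl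
  rw [pairing, alpha, beta]
  simp only [S.integral_spectralMeasure _ _ (S.weight_numA T),
    S.integral_spectralMeasure _ _ (S.weight_numB T)]
  set p := S.fourier T.fst (S.chi ε i)
  set q := S.fourier T.snd (S.chi ε j)
  have key : ∀ (x : S.Eigenvalues T.fst) (y : S.Eigenvalues T.snd),
      S.weight T.fst (T.numA S) (x : ℝ) * (S.weight T.snd (T.numB S) (y : ℝ) *
        (p (x : ℝ) * q (y : ℝ) / (((x : ℝ) : ℂ) + ((y : ℝ) : ℂ)))) =
      ∑ k, S.mass k * ((S.phi (x : ℝ) (S.pos k) 0 * p (x : ℝ) /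
          deriv (fun y => S.phi y 1 T.fst) ((x : ℝ) : ℂ)) *
        (S.phi (y : ℝ) (S.pos k) 0 * q (y : ℝ) /
          deriv (fun y => S.phi y 1 T.snd) ((y : ℝ) : ℂ))) := by
    intro x y
    obtain ⟨x', hx', hxe, -⟩ := S.exists_pos_of_mem_spectrum x.2
    obtain ⟨y', hy', hye, -⟩ := S.exists_pos_of_mem_spectrum y.2
    have hne : ((x : ℝ) : ℂ) + ((y : ℝ) : ℂ) ≠ 0 := by
      rw [hxe, hye]
      exact_mod_cast (add_pos hx' hy').ne'
    have h := S.numA_mul_numB T x.2 y.2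
    rw [weight, weight]
    calc _ = T.numA S (x : ℝ) * T.numB S (y : ℝ) / (((x : ℝ) : ℂ) + ((y : ℝ) : ℂ)) *
          (p (x : ℝ) * q (y : ℝ) / (deriv (fun y => S.phi y 1 T.fst) ((x : ℝ) : ℂ) *
            deriv (fun y => S.phi y 1 T.snd) ((y : ℝ) : ℂ))) := by
          ring
      _ = _ := by
          rw [h, mul_div_cancel_left₀ _ hne, Finset.sum_mul]
          exact Finset.sum_congr rfl fun k _ => by ring
  calc _ = ∑ x : S.Eigenvalues T.fst, ∑ y : S.Eigenvalues T.snd, ∑ k,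
        S.mass k * ((S.phi (x : ℝ) (S.pos k) 0 * p (x : ℝ) /
          deriv (fun y => S.phi y 1 T.fst) ((x : ℝ) : ℂ)) *
        (S.phi (y : ℝ) (S.pos k) 0 * q (y : ℝ) /
          deriv (fun y => S.phi y 1 T.snd) ((y : ℝ) : ℂ))) := by
        refine Finset.sum_congr rfl fun x _ => ?_
        rw [Finset.mul_sum]
        exact Finset.sum_congr rfl fun y _ => key x y
    _ = ∑ k, S.mass k * ((∑ x : S.Eigenvalues T.fst, S.phi (x : ℝ) (S.pos k) 0 * p (x : ℝ) /
          deriv (fun y => S.phi y 1 T.fst) ((x : ℝ) : ℂ)) *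
        (∑ y : S.Eigenvalues T.snd, S.phi (y : ℝ) (S.pos k) 0 * q (y : ℝ) /
          deriv (fun y => S.phi y 1 T.snd) ((y : ℝ) : ℂ))) := by
        rw [Finset.sum_congr rfl fun x _ => Finset.sum_comm, Finset.sum_comm]
        refine Finset.sum_congr rfl fun k _ => ?_
        simp only [Finset.sum_mul_sum, ← Finset.mul_sum]
    _ = _ := by
        simp only [p, q, S.sum_eigenvalues_phi_fourier ha hε hdisj,
          S.sum_eigenvalues_phi_fourier hb hε hdisj]
        -- The two factors are minus Kronecker deltas at `i.rev` and `j.rev`; their signs cancel,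
        -- leaving one mass when i = j.
        rw [Finset.sum_eq_single i.rev]
        · by_cases hij : i = j <;> simp [hij, Fin.rev_inj]
        · intro k _ hk
          simp [hk]
        · simp

end CubicString

end

theorem mainTheorem3 {n : ℕ} (S : CubicString n) (T : TypePair)
    (hT : (∀ i, S.pos i < 1) ∨ T = TypePair.t22)
    (ε : ℝ) (hε : 0 < ε) (hdisj : Pairwise fun i j => Disjoint (S.window ε i) (S.window ε j)) :
    -- the discrete measures are genuine: real positive eigenvalues with positive weights
    ((S.spectrum T.fst).Finite ∧ ∀ z ∈ S.spectrum T.fst, ∃ x A : ℝ, 0 < x ∧ 0 < A ∧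
      z = x ∧ S.weight T.fst (T.numA S) z = A) ∧
    ((S.spectrum T.snd).Finite ∧ ∀ z ∈ S.spectrum T.snd, ∃ y B : ℝ, 0 < y ∧ 0 < B ∧
      z = y ∧ S.weight T.snd (T.numB S) z = B) ∧
    -- the transforms are polynomials of degree `j`
    (∀ j : Fin n, ∃ p : Polynomial ℝ, p.degree = (j : ℕ) ∧
      ∀ z : ℂ, S.fourier T.fst (S.chi ε j) z = Polynomial.aeval z p) ∧
    (∀ j : Fin n, ∃ q : Polynomial ℝ, q.degree = (j : ℕ) ∧
      ∀ z : ℂ, S.fourier T.snd (S.chi ε j) z = Polynomial.aeval z q) ∧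
    -- biorthogonality
    (∀ i j : Fin n, i ≠ j →
      S.pairing T (S.fourier T.fst (S.chi ε i)) (S.fourier T.snd (S.chi ε j)) = 0) ∧
    (∀ i : Fin n,
      S.pairing T (S.fourier T.fst (S.chi ε i)) (S.fourier T.snd (S.chi ε i)) ≠ 0) := by
  have ha : T.fst = 2 ∨ ∀ i, S.pos i < 1 := hT.symm.imp_left fun h => by rw [h]; rfl
  have hb : T.snd = 2 ∨ ∀ i, S.pos i < 1 := hT.symm.imp_left fun h => by rw [h]; rfl
  refine ⟨⟨S.finite_spectrum _, fun z hz => ?_⟩, ⟨S.finite_spectrum _, fun z hz => ?_⟩,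
    S.exists_fourier_degree ha hε hdisj, S.exists_fourier_degree hb hε hdisj,
    fun i j hij => ?_, fun i => ?_⟩
  · obtain ⟨x, hx, rfl, h⟩ := S.exists_pos_of_mem_spectrum hz
    obtain ⟨A, hA, hw⟩ := S.weight_numA_pos T hx h
    exact ⟨x, A, hx, hA, rfl, hw⟩
  · obtain ⟨x, hx, rfl, h⟩ := S.exists_pos_of_mem_spectrum hz
    obtain ⟨A, hA, hw⟩ := S.weight_numB_pos T hx h
    exact ⟨x, A, hx, hA, rfl, hw⟩
  · rw [S.pairing_fourier T hT hε hdisj, if_neg hij]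
  · rw [S.pairing_fourier T hT hε hdisj, if_pos rfl]
    exact_mod_cast (S.mass_pos i.rev).ne'
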